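/- Let $\delta=z\,\frac{d}{dz}$ and let $D=\{z\in\mathbb C:|z|<4/27\}$. There is a sequence $A_0,A_1,A_2,\dots$ of holomorphic functions on $D$ such that $A=\sum_{k\ge0}A_k(z)\,a^{-2k}$ is a formal solution (formal power series in $a^{-2}$, with $\delta$ acting on the coefficients) of $$a^2\bigl(z(1+A)^3-A\bigr)=(1+A)\,\delta^2A-(\delta A)^2 .$$ For every such sequence, define the numbers $A_k[n]$ by the Taylor expansion $A_k(z)=(-1)^k\sum_{n}A_k[n]z^n$ at $z=0$. Then for every $k\ge1$ there is a polynomial $R_{3(k-1)}$ with integer coefficients and of degree at most $3(k-1)$ (determined uniquely by the following identity) such that on $D$ $$A_k=-A_0\,\frac{(1+A_0)^{2(k+1)}}{(2A_0-1)^{5k-1}}\,R_{3(k-1)}(A_0),$$ and, with the convention $R_{-3}(\tfrac12):=-(\tfrac23)^2$ for $k=0$, for each fixed $k\ge0$, as $n\to\infty$, $$A_k[n]=\frac{3^{(5-k)/2}}{2^{2k+3}}\,\frac{R_{3(k-1)}(\frac12)}{\Gamma\left(\frac{5k-1}{2}\right)}\,n^{(5k-3)/2}\left(\frac{27}{4}\right)^{n}\bigl(1+o(1)\bigr).$$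 -/

import Mathlib

open Filter Asymptotics Polynomial

noncomputable section

namespace DegenerateP3

/-- The disc `|z| < 2² / 3³`. -/
def disc : Set ℂ := Metric.ball 0 (4 / 27)

/-- The Euler operator `δ_z = z d/dz`. -/
def delta (f : ℂ → ℂ) : ℂ → ℂ := fun z => z * deriv f z

/-- For fixed `z`, the formal series `∑ₖ fₖ(z) ε^k` in the formal variable `ε = a⁻²`. -/
def epsSeries (f : ℕ → ℂ → ℂ) (z : ℂ) : PowerSeries ℂ := PowerSeries.mk fun k => f k z

/-- The functions `A₀, A₁, …` are holomorphic in the disc and `A = ∑ₖ Aₖ(z) a^{-2k}` formally solves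
`a² (z (1 + A)³ - A) = (1 + A) δ²A - (δA)²`.
Both sides are multiplied by `ε = a⁻²`, which is the variable `PowerSeries.X`, and `δ` acts on `A`
coefficientwise. -/
structure IsFormalSolution (A : ℕ → ℂ → ℂ) : Prop where
  holomorphic : ∀ k, DifferentiableOn ℂ (A k) disc
  solves : ∀ z ∈ disc,
    PowerSeries.C z * (1 + epsSeries A z) ^ 3 - epsSeries A z =
      PowerSeries.X *
        ((1 + epsSeries A z) * epsSeries (fun k => delta (delta (A k))) z -
          epsSeries (fun k => delta (A k)) z ^ 2)

/-- `Aₖ[n]`, defined by the Taylor expansion `Aₖ(z) = (-1)^k ∑ₙ Aₖ[n] zⁿ` at `z = 0`. -/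
def taylorCoeff (A : ℕ → ℂ → ℂ) (k n : ℕ) : ℂ :=
  (-1) ^ k * (iteratedDeriv n (A k) 0 / (n.factorial : ℂ))

/-- For `k ≥ 1`: the integer polynomial `R = R_{3(k-1)}` in
`Aₖ = -A₀ (1 + A₀)^{2(k+1)} / (-1 + 2 A₀)^{5k-1} · R(A₀)`.
(The identity alone determines `R`; `2 A₀ ≠ 1` in the disc.) -/
structure IsRPolynomial (A : ℕ → ℂ → ℂ) (k : ℕ) (R : ℤ[X]) : Prop where
  natDegree_le : R.natDegree ≤ 3 * (k - 1)
  eq_on_disc : ∀ z ∈ disc,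
    A k z = -A 0 z * ((1 + A 0 z) ^ (2 * (k + 1)) / (-1 + 2 * A 0 z) ^ (5 * k - 1)) *
      aeval (A 0 z) R

/-- The number `R_{3(k-1)}(1/2)`, with the convention `R_{-3}(1/2) = -(2/3)²` for `k = 0`. -/
def valueAtHalf (R : ℕ → ℤ[X]) (k : ℕ) : ℝ :=
  if k = 0 then -(2 / 3) ^ 2 else aeval (1 / 2 : ℝ) (R k)

/-- `3^{(5-k)/2} / 2^{2k+3} · R_{3(k-1)}(1/2) / Γ((5k-1)/2) · n^{(5k-3)/2} · (3³/2²)ⁿ`. -/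
def mainTerm (R : ℕ → ℤ[X]) (k n : ℕ) : ℝ :=
  (3 : ℝ) ^ ((5 - (k : ℝ)) / 2) / 2 ^ (2 * k + 3) *
    (valueAtHalf R k / Real.Gamma ((5 * (k : ℝ) - 1) / 2)) *
    (n : ℝ) ^ ((5 * (k : ℝ) - 3) / 2) * ((3 : ℝ) ^ 3 / 2 ^ 2) ^ n

end DegenerateP3

end

/-!
At `ε = a⁻² = 0` the equation is the cubic `z (1 + w)³ = w`, whose solution in the disc is the
unique `A₀ = w`. For an order-by-order solution only the linearization `(2 w - 1) / (1 + w)` of the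
cubic has to be inverted, and it vanishes only over the boundary point `z = 4 / 27`, `w = 1 / 2`;
so `w` determines all of `A`.

To find `A`, write `1 + A = (1 + w) S`. The right-hand side is `(1 + A)² δ² log (1 + A)`, so the
factor `1 + w` only contributes the multiple `δ² log (1 + w)` of `(1 + A)²`. Since
`(2 w - 1) δ w = -w (1 + w)`, the operator `(2 w - 1)² δ` acts on `ℤ[w]` and scales the variable
`μ = ε (1 + w)² / (2 w - 1)⁵` by a polynomial in `w`. With `S = 1 - w (w + 1) (2 w - 1) μ P` the
equation becomes `P = 1 + μ (⋯)`, a contraction of `ℤ[w][[μ]]`, and `R_{3k}` is the coefficient of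
`μ ^ k` in its fixed point. At `w = 1 / 2` the recursion has positive coefficients, hence
`R_{3k}(1 / 2) > 0`.

For the asymptotics put `v = 1 / (1 - 2 w)`. The coefficients of `(1 + w) v` satisfy a first order
recursion, so Euler's limit for `Γ` yields their growth. Those of `v = (2 (1 + w) v + 1) / 3`
behave like those of `3 ^ (-1 / 2) (1 - 27 z / 4) ^ (-1 / 2)`, and `(δ + 1 / 2) w = 3 / 4 (v - 1)`
gives those of `w`. Such behaviour is multiplicative, so that of a polynomial `G(w)` times `v ^ m`
is governed by `G(1 / 2) 3 ^ (-m / 2) (1 - 27 z / 4) ^ (-m / 2)`: the remainder `G(w) - G(1 / 2)`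
is divisible by `w - 1 / 2`, and `(w - 1 / 2) v = -1 / 2` lowers the exponent.
-/

noncomputable section

namespace DegenerateP3

open scoped PowerSeries

section Contraction

variable {R : Type*} [CommRing R]

/-- Contractions for the `X`-adic metric: applying `F` makes two series agree to one order more. -/
def IsXAdicContraction (F : R⟦X⟧ → R⟦X⟧) : Prop :=
  ∀ n f g, PowerSeries.X ^ n ∣ f - g → PowerSeries.X ^ (n + 1) ∣ F f - F g

/-- The limit of `F^[n] 0`, which is a fixed point when `F` is an `X`-adic contraction. -/
def xAdicFixedPoint (F : R⟦X⟧ → R⟦X⟧) : R⟦X⟧ :=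
  PowerSeries.mk fun k => PowerSeries.coeff k (F^[k + 1] 0)

theorem coeff_eq_of_X_pow_dvd_sub {f g : R⟦X⟧} {k n : ℕ} (h : PowerSeries.X ^ n ∣ f - g)
    (hk : k < n) : PowerSeries.coeff k f = PowerSeries.coeff k g :=
  sub_eq_zero.mp (by simpa using PowerSeries.X_pow_dvd_iff.mp h k hk)

namespace IsXAdicContraction

variable {F : R⟦X⟧ → R⟦X⟧} (hF : IsXAdicContraction F)

include hF

theorem X_pow_dvd_iterate_sub (m n : ℕ) : PowerSeries.X ^ n ∣ F^[n + m] 0 - F^[n] 0 := by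
  induction n with
  | zero => simp
  | succ n ih =>
    rw [Nat.add_right_comm, Function.iterate_succ_apply', Function.iterate_succ_apply']
    exact hF n _ _ ih

theorem X_pow_dvd_xAdicFixedPoint_sub (n : ℕ) :
    PowerSeries.X ^ n ∣ xAdicFixedPoint F - F^[n] 0 := by
  rw [PowerSeries.X_pow_dvd_iff]
  intro k hk
  obtain ⟨m, rfl⟩ := Nat.exists_eq_add_of_lt hk
  rw [map_sub, xAdicFixedPoint, PowerSeries.coeff_mk, sub_eq_zero, Nat.add_right_comm]
  exact (coeff_eq_of_X_pow_dvd_sub (hF.X_pow_dvd_iterate_sub m (k + 1)) k.lt_succ_self).symm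

theorem coeff_xAdicFixedPoint {k n : ℕ} (hk : k < n) :
    PowerSeries.coeff k (xAdicFixedPoint F) = PowerSeries.coeff k (F^[n] 0) :=
  coeff_eq_of_X_pow_dvd_sub (hF.X_pow_dvd_xAdicFixedPoint_sub n) hk

theorem map_xAdicFixedPoint : F (xAdicFixedPoint F) = xAdicFixedPoint F := by
  ext k
  rw [hF.coeff_xAdicFixedPoint (k.lt_succ_self), Function.iterate_succ_apply']
  exact coeff_eq_of_X_pow_dvd_sub (hF k _ _ (hF.X_pow_dvd_xAdicFixedPoint_sub k)) k.lt_succ_self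

end IsXAdicContraction

end Contraction

section Recursion

/-- The polynomial `q` such that `(2 * w - 1) ^ 2 * δ w = -q(w)` on the branch `w`. -/
def branchPoly : ℤ[X] := X * (X + 1) * (2 * X - 1)

/-- The operator `(2 * w - 1) ^ 2 * δ + c` on the series in `μ = ε * (1 + w) ^ 2 / (2 * w - 1) ^ 5`
with coefficients polynomial in the branch `w` of `z * (1 + w) ^ 3 = w`. The factor
`6 * X * (X + 2) * k` is the logarithmic derivative `(2 * w - 1) ^ 2 * δ (μ ^ k) / μ ^ k`. -/
def weightedEuler (c : ℤ[X]) : ℤ[X]⟦X⟧ →+ ℤ[X]⟦X⟧ where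
  toFun F := PowerSeries.mk fun k =>
    -branchPoly * derivative (PowerSeries.coeff k F) +
      (6 * X * (X + 2) * (k : ℤ[X]) + c) * PowerSeries.coeff k F
  map_zero' := by ext1 k; simp
  map_add' F G := by ext1 k; simp only [PowerSeries.coeff_mk, map_add]; ring

theorem coeff_weightedEuler (c : ℤ[X]) (F : ℤ[X]⟦X⟧) (k : ℕ) :
    PowerSeries.coeff k (weightedEuler c F) =
      -branchPoly * derivative (PowerSeries.coeff k F) +
        (6 * X * (X + 2) * (k : ℤ[X]) + c) * PowerSeries.coeff k F := by
  simp [weightedEuler]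

theorem X_pow_dvd_weightedEuler (c : ℤ[X]) {F : ℤ[X]⟦X⟧} {n : ℕ} (h : PowerSeries.X ^ n ∣ F) :
    PowerSeries.X ^ n ∣ weightedEuler c F := by
  rw [PowerSeries.X_pow_dvd_iff] at h ⊢
  intro k hk
  simp [coeff_weightedEuler, h k hk]

theorem X_pow_dvd_weightedEuler_sub (c : ℤ[X]) {F G : ℤ[X]⟦X⟧} {n : ℕ}
    (h : PowerSeries.X ^ n ∣ F - G) :
    PowerSeries.X ^ n ∣ weightedEuler c F - weightedEuler c G := by
  rw [← map_sub]
  exact X_pow_dvd_weightedEuler c h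

theorem weightedEuler_add (b c : ℤ[X]) (F : ℤ[X]⟦X⟧) :
    weightedEuler (b + c) F = weightedEuler b F + PowerSeries.C c * F := by
  ext1 k
  simp only [coeff_weightedEuler, map_add, PowerSeries.coeff_C_mul]
  ring

theorem weightedEuler_one (c : ℤ[X]) : weightedEuler c 1 = PowerSeries.C c := by
  ext1 k
  rcases k with _ | k <;> simp [coeff_weightedEuler, PowerSeries.coeff_one, PowerSeries.coeff_C]

theorem weightedEuler_branchPoly_mul_X_mul (c : ℤ[X]) (F : ℤ[X]⟦X⟧) :
    weightedEuler c (PowerSeries.C branchPoly * (PowerSeries.X * F)) =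
      PowerSeries.C branchPoly * (PowerSeries.X * weightedEuler (c + 10 * X + 1) F) := by
  ext1 k
  rcases k with _ | k
  · simp [coeff_weightedEuler]
  · simp only [coeff_weightedEuler, PowerSeries.coeff_C_mul, PowerSeries.coeff_succ_X_mul,
      derivative_mul, branchPoly, derivative_add, derivative_sub, derivative_X, derivative_one,
      derivative_ofNat, Nat.cast_add, Nat.cast_one]
    ring

/-- If `S = 1 - q μ P`, with `q = branchPoly`, then `(2 * w - 1) ^ 2 * δ S` is
`-q μ * firstEuler P`. -/
def firstEuler (P : ℤ[X]⟦X⟧) : ℤ[X]⟦X⟧ := weightedEuler (10 * X + 1) P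

/-- If `S = 1 - q μ P`, with `q = branchPoly`, then `(2 * w - 1) ^ 4 * δ (δ S)` is
`-q μ * secondEuler P`. -/
def secondEuler (P : ℤ[X]⟦X⟧) : ℤ[X]⟦X⟧ :=
  weightedEuler (4 * X * (X + 1) + 10 * X + 1) (firstEuler P)

/-- The map whose fixed point `P` makes `(1 + w) * (1 - q μ P)`, with `q = branchPoly`, equal to
`1 + A` for the formal solution `A` with leading term `w`. -/
def rStep (P : ℤ[X]⟦X⟧) : ℤ[X]⟦X⟧ :=
  1 + PowerSeries.X * (secondEuler P - PowerSeries.C (2 * branchPoly) * P +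
      PowerSeries.C (3 * X ^ 2 * (X + 1)) * P ^ 2) +
    PowerSeries.X ^ 2 * (PowerSeries.C branchPoly * (PowerSeries.C branchPoly * P ^ 2 -
      PowerSeries.C (X ^ 2 * (X + 1)) * P ^ 3 - P * secondEuler P + firstEuler P ^ 2))

theorem isXAdicContraction_rStep : IsXAdicContraction rStep := by
  intro n P Q h
  obtain ⟨d₁, h₁⟩ : PowerSeries.X ^ n ∣ firstEuler P - firstEuler Q :=
    X_pow_dvd_weightedEuler_sub _ h
  obtain ⟨d₂, h₂⟩ : PowerSeries.X ^ n ∣ secondEuler P - secondEuler Q :=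
    X_pow_dvd_weightedEuler_sub _ (X_pow_dvd_weightedEuler_sub _ h)
  obtain ⟨d, h⟩ := h
  refine ⟨d₂ - PowerSeries.C (2 * branchPoly) * d +
    PowerSeries.C (3 * X ^ 2 * (X + 1)) * (P + Q) * d +
    PowerSeries.X * PowerSeries.C branchPoly * (PowerSeries.C branchPoly * (P + Q) * d -
      PowerSeries.C (X ^ 2 * (X + 1)) * (P ^ 2 + P * Q + Q ^ 2) * d -
      (P * d₂ + secondEuler Q * d) + (firstEuler P + firstEuler Q) * d₁), ?_⟩
  simp only [rStep]
  linear_combination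
    (PowerSeries.X - PowerSeries.X ^ 2 * PowerSeries.C branchPoly * P) * h₂ +
    PowerSeries.X ^ 2 * PowerSeries.C branchPoly * (firstEuler P + firstEuler Q) * h₁ +
    (PowerSeries.X * (PowerSeries.C (3 * X ^ 2 * (X + 1)) * (P + Q) -
        PowerSeries.C (2 * branchPoly)) +
      PowerSeries.X ^ 2 * PowerSeries.C branchPoly * (PowerSeries.C branchPoly * (P + Q) -
        PowerSeries.C (X ^ 2 * (X + 1)) * (P ^ 2 + P * Q + Q ^ 2) - secondEuler Q)) * h

/-- The generating series `∑ k, R_{3k}(w) μ ^ k` of the polynomials of the theorem. -/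
def rSeries : ℤ[X]⟦X⟧ := xAdicFixedPoint rStep

theorem rStep_rSeries : rStep rSeries = rSeries := isXAdicContraction_rStep.map_xAdicFixedPoint

/-- The series `S = (1 + A) / (1 + A₀)`, expanded in `μ`. -/
def solSeries : ℤ[X]⟦X⟧ := 1 - PowerSeries.C branchPoly * (PowerSeries.X * rSeries)

theorem weightedEuler_zero_solSeries :
    weightedEuler 0 solSeries =
      -(PowerSeries.C branchPoly * (PowerSeries.X * firstEuler rSeries)) := by
  rw [solSeries, map_sub, weightedEuler_one, weightedEuler_branchPoly_mul_X_mul, map_zero, zero_sub,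
    zero_add, firstEuler]

theorem weightedEuler_weightedEuler_zero_solSeries :
    weightedEuler (4 * X * (X + 1)) (weightedEuler 0 solSeries) =
      -(PowerSeries.C branchPoly * (PowerSeries.X * secondEuler rSeries)) := by
  rw [weightedEuler_zero_solSeries, map_neg, weightedEuler_branchPoly_mul_X_mul]
  rfl

theorem solSeries_equation :
    PowerSeries.C X * solSeries ^ 3 - (1 + PowerSeries.C X) * solSeries + 1 =
      PowerSeries.X * PowerSeries.C (2 * X - 1) *
        (solSeries * weightedEuler (4 * X * (X + 1)) (weightedEuler 0 solSeries) -
          weightedEuler 0 solSeries ^ 2 - PowerSeries.C branchPoly * solSeries ^ 2) := by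
  have key := rStep_rSeries
  rw [weightedEuler_weightedEuler_zero_solSeries, weightedEuler_zero_solSeries]
  simp only [rStep, solSeries, branchPoly, map_mul, map_add, map_sub, map_pow, map_ofNat, map_one]
    at key ⊢
  linear_combination
    PowerSeries.C X * (PowerSeries.C X + 1) * (2 * PowerSeries.C X - 1) ^ 2 * PowerSeries.X * key

end Recursion

section Degree

theorem coeff_X_mul_derivative {R : Type*} [CommRing R] (p : R[X]) (n : ℕ) :
    (X * derivative p).coeff n = n * p.coeff n := by
  rcases n with _ | n
  · simp
  · rw [coeff_X_mul, coeff_derivative, mul_comm]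
    push_cast
    rfl

theorem natDegree_X_mul_derivative_le {R : Type*} [CommRing R] (p : R[X]) :
    (X * derivative p).natDegree ≤ p.natDegree := by
  rw [natDegree_le_iff_coeff_eq_zero]
  intro n hn
  rw [coeff_X_mul_derivative, coeff_eq_zero_of_natDegree_lt hn, mul_zero]

theorem natDegree_X_sq_mul_X_mul_derivative_sub_le {R : Type*} [CommRing R] {p : R[X]} {d : ℕ}
    (hp : p.natDegree ≤ d) : (X ^ 2 * (X * derivative p - (d : R[X]) * p)).natDegree ≤ d + 1 := by
  rw [natDegree_le_iff_coeff_eq_zero]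
  intro N hN
  obtain ⟨m, rfl⟩ : ∃ m, N = m + 2 := ⟨N - 2, by omega⟩
  rw [coeff_X_pow_mul, coeff_sub, ← C_eq_natCast, coeff_C_mul, coeff_X_mul_derivative,
    ← sub_mul]
  rcases (show d ≤ m by omega).eq_or_lt with rfl | hdm
  · rw [sub_self, zero_mul]
  · rw [coeff_eq_zero_of_natDegree_lt (hp.trans_lt hdm), mul_zero]

/-- The `k`-th coefficient of `F` has degree at most `3 * k + d`. -/
def DegreeLE (d : ℕ) (F : ℤ[X]⟦X⟧) : Prop :=
  ∀ k, (PowerSeries.coeff k F).natDegree ≤ 3 * k + d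

namespace DegreeLE

variable {d e : ℕ} {F G : ℤ[X]⟦X⟧}

theorem mono (h : d ≤ e) (hF : DegreeLE d F) : DegreeLE e F := fun k =>
  (hF k).trans (by omega)

theorem one : DegreeLE 0 1 := fun k => by
  rw [PowerSeries.coeff_one]
  split_ifs <;> simp

theorem add (hF : DegreeLE d F) (hG : DegreeLE d G) : DegreeLE d (F + G) := fun k => by
  rw [map_add]
  exact natDegree_add_le_of_degree_le (hF k) (hG k)

theorem sub (hF : DegreeLE d F) (hG : DegreeLE d G) : DegreeLE d (F - G) := fun k => by
  rw [map_sub]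
  simpa using natDegree_sub_le_of_le (hF k) (hG k)

theorem mul (hF : DegreeLE d F) (hG : DegreeLE e G) : DegreeLE (d + e) (F * G) := fun k => by
  rw [PowerSeries.coeff_mul]
  refine natDegree_sum_le_of_forall_le _ _ fun ⟨i, j⟩ hij => ?_
  rw [Finset.HasAntidiagonal.mem_antidiagonal] at hij
  exact (natDegree_mul_le_of_le (hF i) (hG j)).trans (by dsimp only at hij; omega)

theorem pow (hF : DegreeLE d F) (n : ℕ) : DegreeLE (n * d) (F ^ n) := by
  induction n with
  | zero => simpa using one
  | succ n ih => simpa only [pow_succ, Nat.succ_mul] using ih.mul hF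

theorem C_mul {c : ℤ[X]} (hc : c.natDegree ≤ e) (hF : DegreeLE d F) :
    DegreeLE (e + d) (PowerSeries.C c * F) := fun k => by
  rw [PowerSeries.coeff_C_mul]
  exact (natDegree_mul_le_of_le hc (hF k)).trans (by omega)

theorem X_mul (hF : DegreeLE (d + 3) F) : DegreeLE d (PowerSeries.X * F)
  | 0 => by simp
  | k + 1 => by
    rw [PowerSeries.coeff_succ_X_mul]
    exact (hF k).trans (by omega)

theorem weightedEuler {c : ℤ[X]} (hc : c.natDegree ≤ 2) (hF : DegreeLE d F) :
    DegreeLE (d + 2) (weightedEuler c F) := fun k => by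
  rw [coeff_weightedEuler]
  have hp := hF k
  generalize PowerSeries.coeff k F = p at *
  have hfac : (6 * X * (X + 2) * (k : ℤ[X]) + c).natDegree ≤ 2 :=
    natDegree_add_le_of_degree_le (by compute_degree) hc
  have hsplit : -branchPoly * derivative p = (1 - X - 2 * X ^ 2) * (X * derivative p) := by
    rw [branchPoly]
    ring
  rw [hsplit]
  refine natDegree_add_le_of_degree_le ?_ ?_
  · refine (natDegree_mul_le_of_le (m := 2) (by compute_degree)
      (natDegree_X_mul_derivative_le p)).trans (by omega)
  · exact (natDegree_mul_le_of_le hfac hp).trans (by omega)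

/-- The terms of degree `3 * k + 2` cancel. -/
theorem weightedEuler_of_natDegree_le_one {c : ℤ[X]} (hc : c.natDegree ≤ 1) (hF : DegreeLE 0 F) :
    DegreeLE 1 (DegenerateP3.weightedEuler c F) := fun k => by
  rw [coeff_weightedEuler]
  have hp : (PowerSeries.coeff k F).natDegree ≤ 3 * k := hF k
  generalize PowerSeries.coeff k F = p at *
  have hfac : (12 * X * (k : ℤ[X]) + c).natDegree ≤ 1 :=
    natDegree_add_le_of_degree_le (by compute_degree) hc
  have hsplit : -branchPoly * derivative p + (6 * X * (X + 2) * (k : ℤ[X]) + c) * p =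
      -2 * (X ^ 2 * (X * derivative p - ((3 * k : ℕ) : ℤ[X]) * p)) +
        (1 - X) * (X * derivative p) + (12 * X * (k : ℤ[X]) + c) * p := by
    rw [branchPoly]
    push_cast
    ring
  rw [hsplit]
  refine natDegree_add_le_of_degree_le (natDegree_add_le_of_degree_le ?_ ?_) ?_
  · refine (natDegree_mul_le_of_le (m := 0) (by compute_degree)
      (natDegree_X_sq_mul_X_mul_derivative_sub_le hp)).trans (by omega)
  · refine (natDegree_mul_le_of_le (m := 1) (by compute_degree)
      (natDegree_X_mul_derivative_le p)).trans (by omega)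
  · exact (natDegree_mul_le_of_le hfac hp).trans (by omega)

theorem firstEuler (hF : DegreeLE 0 F) : DegreeLE 1 (firstEuler F) :=
  hF.weightedEuler_of_natDegree_le_one (by compute_degree)

theorem secondEuler (hF : DegreeLE 0 F) : DegreeLE 3 (secondEuler F) :=
  hF.firstEuler.weightedEuler (by compute_degree)

theorem rStep (hF : DegreeLE 0 F) : DegreeLE 0 (rStep F) := by
  have hq : branchPoly.natDegree ≤ 3 := by rw [branchPoly]; compute_degree
  have hlinear : DegreeLE 3 (DegenerateP3.secondEuler F - PowerSeries.C (2 * branchPoly) * F +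
      PowerSeries.C (3 * X ^ 2 * (X + 1)) * F ^ 2) := by
    refine (hF.secondEuler.sub (hF.C_mul (e := 3) ?_)).add ((hF.pow 2).C_mul (e := 3) ?_)
    · exact natDegree_mul_le_of_le (m := 0) (by compute_degree) hq
    · compute_degree
  have hquadratic : DegreeLE 3 (PowerSeries.C branchPoly * F ^ 2 -
      PowerSeries.C (X ^ 2 * (X + 1)) * F ^ 3 - F * DegenerateP3.secondEuler F +
      DegenerateP3.firstEuler F ^ 2) := by
    refine ((((hF.pow 2).C_mul hq).sub ((hF.pow 3).C_mul (e := 3) ?_)).sub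
      (hF.mul hF.secondEuler)).add ((hF.firstEuler.pow 2).mono (by norm_num))
    compute_degree
  rw [DegenerateP3.rStep, sq PowerSeries.X, mul_assoc PowerSeries.X]
  exact (one.add hlinear.X_mul).add (hquadratic.C_mul hq).X_mul.X_mul

theorem rSeries : DegreeLE 0 rSeries := fun k => by
  rw [DegenerateP3.rSeries, isXAdicContraction_rStep.coeff_xAdicFixedPoint k.lt_succ_self]
  suffices h : ∀ n, DegreeLE 0 (DegenerateP3.rStep^[n] 0) from h _ k
  intro n
  induction n with
  | zero => exact fun k => by simp
  | succ n ih =>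
    rw [Function.iterate_succ_apply']
    exact ih.rStep

end DegreeLE

end Degree

section ValueAtHalf

/-- The coefficientwise value of a series at the branch point `w = 1 / 2`. -/
def evalHalf : ℤ[X]⟦X⟧ →+* ℝ⟦X⟧ := PowerSeries.map (aeval (1 / 2 : ℝ) : ℤ[X] →ₐ[ℤ] ℝ).toRingHom

theorem coeff_evalHalf (F : ℤ[X]⟦X⟧) (k : ℕ) :
    PowerSeries.coeff k (evalHalf F) = aeval (1 / 2 : ℝ) (PowerSeries.coeff k F) :=
  PowerSeries.coeff_map _ _ _

theorem evalHalf_C (P : ℤ[X]) :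
    evalHalf (PowerSeries.C P) = PowerSeries.C (aeval (1 / 2 : ℝ) P) :=
  PowerSeries.map_C _ _

theorem evalHalf_X : evalHalf PowerSeries.X = PowerSeries.X := PowerSeries.map_X _

theorem aeval_half_branchPoly : aeval (1 / 2 : ℝ) branchPoly = 0 := by
  simp only [branchPoly, map_mul, map_add, map_sub, aeval_X, map_ofNat, map_one]
  norm_num

theorem coeff_evalHalf_weightedEuler (c : ℤ[X]) (F : ℤ[X]⟦X⟧) (k : ℕ) :
    PowerSeries.coeff k (evalHalf (weightedEuler c F)) =
      (15 / 2 * k + aeval (1 / 2 : ℝ) c) * PowerSeries.coeff k (evalHalf F) := by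
  simp only [coeff_evalHalf, coeff_weightedEuler, map_add, map_mul, map_neg,
    aeval_half_branchPoly, map_natCast, aeval_X, map_ofNat]
  ring

theorem evalHalf_rStep (P : ℤ[X]⟦X⟧) : evalHalf (rStep P) =
    1 + PowerSeries.X * (evalHalf (secondEuler P) + PowerSeries.C (9 / 8) * evalHalf P ^ 2) := by
  have h : aeval (1 / 2 : ℝ) (3 * X ^ 2 * (X + 1) : ℤ[X]) = 9 / 8 := by
    simp only [map_mul, map_add, map_pow, aeval_X, map_ofNat, map_one]
    norm_num
  simp only [rStep, map_add, map_sub, map_mul _ (PowerSeries.X ^ 2), map_mul _ PowerSeries.X,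
    map_mul _ (PowerSeries.C _), map_pow, evalHalf_X, evalHalf_C, h, map_mul (aeval _),
    aeval_half_branchPoly, map_one, map_zero, mul_zero, zero_mul, add_zero, sub_zero]

theorem coeff_zero_evalHalf_rSeries : PowerSeries.coeff 0 (evalHalf rSeries) = 1 := by
  rw [← rStep_rSeries, evalHalf_rStep]
  simp

theorem coeff_succ_evalHalf_rSeries (k : ℕ) :
    PowerSeries.coeff (k + 1) (evalHalf rSeries) =
      (15 / 2 * k + 9) * (15 / 2 * k + 6) * PowerSeries.coeff k (evalHalf rSeries) +
        9 / 8 * ∑ p ∈ Finset.HasAntidiagonal.antidiagonal k,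
          PowerSeries.coeff p.1 (evalHalf rSeries) * PowerSeries.coeff p.2 (evalHalf rSeries) := by
  conv_lhs => rw [← rStep_rSeries, evalHalf_rStep]
  rw [map_add, PowerSeries.coeff_one, if_neg k.succ_ne_zero, PowerSeries.coeff_succ_X_mul, map_add,
    PowerSeries.coeff_C_mul, sq, PowerSeries.coeff_mul, secondEuler, firstEuler,
    coeff_evalHalf_weightedEuler, coeff_evalHalf_weightedEuler]
  simp only [map_add, map_mul, map_one, map_ofNat, aeval_X]
  ring

theorem coeff_evalHalf_rSeries_pos (k : ℕ) : 0 < PowerSeries.coeff k (evalHalf rSeries) := by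
  induction k using Nat.strong_induction_on with
  | _ k ih =>
    rcases k with _ | k
    · simp [coeff_zero_evalHalf_rSeries]
    · rw [coeff_succ_evalHalf_rSeries]
      have hk := ih k k.lt_succ_self
      refine add_pos_of_pos_of_nonneg (by positivity) (mul_nonneg (by norm_num) ?_)
      refine Finset.sum_nonneg fun p hp => ?_
      rw [Finset.HasAntidiagonal.mem_antidiagonal] at hp
      exact (mul_pos (ih _ (by omega)) (ih _ (by omega))).le

end ValueAtHalf

section Branch

theorem isOpen_disc : IsOpen disc := Metric.isOpen_ball

theorem zero_mem_disc : (0 : ℂ) ∈ disc := by simp [disc]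

theorem norm_lt_of_mem_disc {z : ℂ} (hz : z ∈ disc) : ‖z‖ < 4 / 27 := by simpa [disc] using hz

theorem eventuallyEq_of_forall_mem_disc {f g : ℂ → ℂ} (h : ∀ z ∈ disc, f z = g z) {z : ℂ}
    (hz : z ∈ disc) : f =ᶠ[nhds z] g :=
  eventually_of_mem (isOpen_disc.mem_nhds hz) h

theorem delta_congr {f g : ℂ → ℂ} (h : ∀ z ∈ disc, f z = g z) {z : ℂ} (hz : z ∈ disc) :
    delta f z = delta g z := by
  rw [delta, delta, (eventuallyEq_of_forall_mem_disc h hz).deriv_eq]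

theorem hasDerivAt_pow_div_pow {f g : ℂ → ℂ} {a b z : ℂ} (hf : HasDerivAt f (a * f z) z)
    (hg : HasDerivAt g (b * g z) z) (hgz : g z ≠ 0) (i j : ℕ) :
    HasDerivAt (fun x => f x ^ i / g x ^ j) ((i * a - j * b) * (f z ^ i / g z ^ j)) z := by
  refine ((hf.pow i).div (hg.pow j) (pow_ne_zero j hgz)).congr_deriv ?_
  rcases i with _ | i <;> rcases j with _ | j <;> simp <;> field_simp <;> ring

/-- A holomorphic solution `w` of `z (1 + w)³ = w` in the disc. -/
structure IsBranch (w : ℂ → ℂ) : Prop where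
  holomorphic : DifferentiableOn ℂ w disc
  eq : ∀ z ∈ disc, z * (1 + w z) ^ 3 = w z

theorem one_add_ne_zero_of_eq {z w : ℂ} (h : z * (1 + w) ^ 3 = w) : 1 + w ≠ 0 := by
  intro hw
  rw [hw] at h
  simp [← h] at hw

theorem two_mul_sub_one_ne_zero_of_eq {z w : ℂ} (hz : z ∈ disc) (h : z * (1 + w) ^ 3 = w) :
    2 * w - 1 ≠ 0 := by
  intro hw
  obtain rfl : w = 1 / 2 := by linear_combination hw / 2
  obtain rfl : z = 4 / 27 := by linear_combination (8 / 27) * h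
  simp [disc] at hz

/-- The substitution of the branch `w` and of `μ = ε (1 + w)² / (2 w - 1)⁵` at the point `z`. -/
def branchEval (w : ℂ → ℂ) (z : ℂ) : ℤ[X]⟦X⟧ →+* ℂ⟦X⟧ :=
  (PowerSeries.rescale ((1 + w z) ^ 2 / (2 * w z - 1) ^ 5)).comp
    (PowerSeries.map (aeval (w z) : ℤ[X] →ₐ[ℤ] ℂ).toRingHom)

theorem coeff_branchEval (w : ℂ → ℂ) (z : ℂ) (F : ℤ[X]⟦X⟧) (k : ℕ) :
    PowerSeries.coeff k (branchEval w z F) =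
      ((1 + w z) ^ 2 / (2 * w z - 1) ^ 5) ^ k * aeval (w z) (PowerSeries.coeff k F) := by
  simp [branchEval, PowerSeries.coeff_rescale]

theorem branchEval_C (w : ℂ → ℂ) (z : ℂ) (P : ℤ[X]) :
    branchEval w z (PowerSeries.C P) = PowerSeries.C (aeval (w z) P) := by
  ext1 k
  rcases k with _ | k <;> simp [coeff_branchEval, PowerSeries.coeff_C]

theorem branchEval_X (w : ℂ → ℂ) (z : ℂ) :
    branchEval w z PowerSeries.X =
      PowerSeries.C ((1 + w z) ^ 2 / (2 * w z - 1) ^ 5) * PowerSeries.X := by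
  simp only [branchEval, RingHom.comp_apply, PowerSeries.map_X, PowerSeries.rescale_X]

/-- The coefficients in `ε` of `(1 + w) / (2 w - 1)ᵐ * F`, as functions of `z`. -/
def branchTerm (w : ℂ → ℂ) (m : ℕ) (F : ℤ[X]⟦X⟧) (k : ℕ) (z : ℂ) : ℂ :=
  (1 + w z) / (2 * w z - 1) ^ m * PowerSeries.coeff k (branchEval w z F)

theorem epsSeries_branchTerm (w : ℂ → ℂ) (m : ℕ) (F : ℤ[X]⟦X⟧) (z : ℂ) :
    epsSeries (branchTerm w m F) z =
      PowerSeries.C ((1 + w z) / (2 * w z - 1) ^ m) * branchEval w z F := by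
  ext1 k
  rw [epsSeries, PowerSeries.coeff_mk, PowerSeries.coeff_C_mul, branchTerm]

theorem branchTerm_eq (w : ℂ → ℂ) (m : ℕ) (F : ℤ[X]⟦X⟧) (k : ℕ) (z : ℂ) :
    branchTerm w m F k z = (1 + w z) ^ (2 * k + 1) / (2 * w z - 1) ^ (5 * k + m) *
      aeval (w z) (PowerSeries.coeff k F) := by
  rw [branchTerm, coeff_branchEval]
  simp only [div_pow, ← pow_mul, pow_add, pow_one]
  ring

namespace IsBranch

variable {w : ℂ → ℂ} (hw : IsBranch w) {z : ℂ} (hz : z ∈ disc)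

include hw hz

theorem one_add_ne_zero : 1 + w z ≠ 0 := one_add_ne_zero_of_eq (hw.eq z hz)

theorem two_mul_sub_one_ne_zero : 2 * w z - 1 ≠ 0 := two_mul_sub_one_ne_zero_of_eq hz (hw.eq z hz)

theorem hasDerivAt : HasDerivAt w (deriv w z) z :=
  ((hw.holomorphic z hz).differentiableAt (isOpen_disc.mem_nhds hz)).hasDerivAt

theorem mul_deriv : z * deriv w z = -(w z * (1 + w z)) / (2 * w z - 1) := by
  have hcubic := (hasDerivAt_id z).mul (((hw.hasDerivAt hz).const_add 1).pow 3)
  have hderiv := hcubic.unique ((hw.hasDerivAt hz).congr_of_eventuallyEq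
    (eventuallyEq_of_forall_mem_disc hw.eq hz))
  simp only [id_eq, Pi.pow_apply, Nat.cast_ofNat] at hderiv
  norm_num at hderiv
  rw [eq_div_iff (hw.two_mul_sub_one_ne_zero hz)]
  linear_combination (z * (1 + w z)) * hderiv -
    ((1 + w z) + 3 * (z * deriv w z)) * hw.eq z hz

theorem hasDerivAt_branchTerm (m : ℕ) (F : ℤ[X]⟦X⟧) (k : ℕ) :
    HasDerivAt (branchTerm w m F k)
      ((((2 * k + 1 : ℕ) : ℂ) * (deriv w z / (1 + w z)) -
          ((5 * k + m : ℕ) : ℂ) * (2 * deriv w z / (2 * w z - 1))) *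
        ((1 + w z) ^ (2 * k + 1) / (2 * w z - 1) ^ (5 * k + m)) *
          aeval (w z) (PowerSeries.coeff k F) +
        (1 + w z) ^ (2 * k + 1) / (2 * w z - 1) ^ (5 * k + m) *
          (aeval (w z) (derivative (PowerSeries.coeff k F)) * deriv w z)) z := by
  have hs := hw.two_mul_sub_one_ne_zero hz
  have hnum : HasDerivAt (fun x => 1 + w x) (deriv w z / (1 + w z) * (1 + w z)) z := by
    rw [div_mul_cancel₀ _ (hw.one_add_ne_zero hz)]
    exact (hw.hasDerivAt hz).const_add 1
  have hden :
      HasDerivAt (fun x => 2 * w x - 1) (2 * deriv w z / (2 * w z - 1) * (2 * w z - 1)) z := by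
    rw [div_mul_cancel₀ _ hs]
    exact ((hw.hasDerivAt hz).const_mul 2).sub_const 1
  have haeval := ((PowerSeries.coeff k F).hasDerivAt_aeval (w z)).comp z (hw.hasDerivAt hz)
  rw [show branchTerm w m F k = _ from funext (branchTerm_eq w m F k)]
  exact (hasDerivAt_pow_div_pow hnum hden hs _ _).mul haeval

theorem delta_branchTerm (m : ℕ) (F : ℤ[X]⟦X⟧) (k : ℕ) :
    delta (branchTerm w m F k) z =
      branchTerm w (m + 2)
        (weightedEuler (X * (1 - 2 * X) + 2 * (m : ℤ[X]) * X * (X + 1)) F) k z := by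
  have hne := hw.one_add_ne_zero hz
  have hs := hw.two_mul_sub_one_ne_zero hz
  have hwz := hw.mul_deriv hz
  rw [delta, (hw.hasDerivAt_branchTerm hz m F k).deriv, branchTerm_eq, coeff_weightedEuler,
    ← add_assoc, pow_add _ _ 2]
  simp only [branchPoly, map_add, map_mul, map_neg, map_sub, aeval_X, map_natCast, map_ofNat,
    map_one]
  generalize deriv w z = w', aeval (w z) (PowerSeries.coeff k F) = p,
    aeval (w z) (derivative (PowerSeries.coeff k F)) = p' at *
  calc _ = (((2 * k + 1 : ℕ) : ℂ) * (z * w' / (1 + w z)) -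
          ((5 * k + m : ℕ) : ℂ) * (2 * (z * w') / (2 * w z - 1))) *
        ((1 + w z) ^ (2 * k + 1) / (2 * w z - 1) ^ (5 * k + m)) * p +
        (1 + w z) ^ (2 * k + 1) / (2 * w z - 1) ^ (5 * k + m) * (p' * (z * w')) := by ring
    _ = _ := by
      rw [hwz]
      push_cast
      field_simp
      ring

end IsBranch

end Branch

section FormalSolution

/-- Since `(1 + A) δ²A - (δA)² = (1 + A)² δ² log (1 + A)`, the factor `1 + w` of `1 + A` contributes
only the term `(1 + A)² δ² log (1 + w)`. -/
theorem mul_weightedEuler_weightedEuler_sub_sq (F : ℤ[X]⟦X⟧) :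
    F * weightedEuler (X * (1 - 2 * X) + 4 * X * (X + 1)) (weightedEuler (X * (1 - 2 * X)) F) -
        weightedEuler (X * (1 - 2 * X)) F ^ 2 =
      F * weightedEuler (4 * X * (X + 1)) (weightedEuler 0 F) - weightedEuler 0 F ^ 2 -
        PowerSeries.C branchPoly * F ^ 2 := by
  have hone : weightedEuler (X * (1 - 2 * X)) F =
      weightedEuler 0 F + PowerSeries.C (X * (1 - 2 * X)) * F := by
    rw [← weightedEuler_add, zero_add]
  have hmul : weightedEuler 0 (PowerSeries.C (X * (1 - 2 * X)) * F) =
      PowerSeries.C (X * (1 - 2 * X)) * weightedEuler 0 F -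
        PowerSeries.C (branchPoly * (1 - 4 * X)) * F := by
    ext1 k
    simp only [map_sub, coeff_weightedEuler, PowerSeries.coeff_C_mul, derivative_mul,
      derivative_X, derivative_one, derivative_ofNat]
    ring
  have hfour (G : ℤ[X]⟦X⟧) : weightedEuler (4 * X * (X + 1)) G =
      weightedEuler 0 G + PowerSeries.C (4 * X * (X + 1)) * G := by
    rw [← weightedEuler_add, zero_add]
  have hc (G : ℤ[X]⟦X⟧) : weightedEuler (X * (1 - 2 * X) + 4 * X * (X + 1)) G =
      weightedEuler (4 * X * (X + 1)) G + PowerSeries.C (X * (1 - 2 * X)) * G := by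
    rw [← weightedEuler_add, add_comm]
  rw [hc, hone, map_add, hfour (_ * F), hmul, branchPoly]
  simp only [map_mul, map_add, map_sub, map_one, map_ofNat]
  ring

/-- The formal solution with leading term `w`: `1 + A = (1 + w) * S`. -/
def branchSolution (w : ℂ → ℂ) (k : ℕ) (z : ℂ) : ℂ :=
  branchTerm w 0 solSeries k z - PowerSeries.coeff k (1 : ℂ⟦X⟧)

theorem one_add_epsSeries_branchSolution (w : ℂ → ℂ) (z : ℂ) :
    1 + epsSeries (branchSolution w) z =
      PowerSeries.C (1 + w z) * branchEval w z solSeries := by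
  ext1 k
  rw [PowerSeries.coeff_C_mul]
  simp [epsSeries, branchSolution, branchTerm]

theorem branchSolution_zero (w : ℂ → ℂ) (z : ℂ) : branchSolution w 0 z = w z := by
  simp [branchSolution, branchTerm_eq, solSeries]

theorem branchSolution_succ (w : ℂ → ℂ) {z : ℂ} (hz : 2 * w z - 1 ≠ 0) (k : ℕ) :
    branchSolution w (k + 1) z =
      -w z * ((1 + w z) ^ (2 * (k + 2)) / (2 * w z - 1) ^ (5 * k + 4)) *
        aeval (w z) (PowerSeries.coeff k rSeries) := by
  have hcoeff : PowerSeries.coeff (k + 1) solSeries =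
      -(branchPoly * PowerSeries.coeff k rSeries) := by
    simp [solSeries, PowerSeries.coeff_one, PowerSeries.coeff_succ_X_mul]
  rw [branchSolution, branchTerm_eq, hcoeff, PowerSeries.coeff_one, if_neg k.succ_ne_zero,
    show 5 * (k + 1) + 0 = (5 * k + 4) + 1 by ring, pow_succ (2 * w z - 1)]
  simp only [branchPoly, map_neg, map_mul, map_add, map_sub, aeval_X, map_ofNat, map_one]
  generalize 2 * w z - 1 = s at *
  field_simp
  ring

theorem delta_branchSolution (w : ℂ → ℂ) (k : ℕ) :
    delta (branchSolution w k) = delta (branchTerm w 0 solSeries k) := by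
  funext z
  exact congrArg (z * ·) (congrFun (deriv_sub_const_fun _) z)

namespace IsBranch

variable {w : ℂ → ℂ} (hw : IsBranch w) {z : ℂ} (hz : z ∈ disc)

include hw hz

theorem delta_branchSolution (k : ℕ) : delta (branchSolution w k) z =
    branchTerm w 2 (weightedEuler (X * (1 - 2 * X)) solSeries) k z := by
  rw [DegenerateP3.delta_branchSolution, hw.delta_branchTerm hz]
  simp

theorem delta_delta_branchSolution (k : ℕ) : delta (delta (branchSolution w k)) z =
    branchTerm w 4 (weightedEuler (X * (1 - 2 * X) + 4 * X * (X + 1))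
      (weightedEuler (X * (1 - 2 * X)) solSeries)) k z := by
  rw [delta_congr (fun x hx => hw.delta_branchSolution hx k) hz, hw.delta_branchTerm hz]
  norm_num

theorem branchSolution_equation :
    PowerSeries.C z * (1 + epsSeries (branchSolution w) z) ^ 3 - epsSeries (branchSolution w) z =
      PowerSeries.X *
        ((1 + epsSeries (branchSolution w) z) *
            epsSeries (fun k => delta (delta (branchSolution w k))) z -
          epsSeries (fun k => delta (branchSolution w k)) z ^ 2) := by
  have hδ : epsSeries (fun k => delta (branchSolution w k)) z = _ :=
    (congrArg PowerSeries.mk (funext (hw.delta_branchSolution hz))).trans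
      (epsSeries_branchTerm w 2 _ z)
  have hδδ : epsSeries (fun k => delta (delta (branchSolution w k))) z = _ :=
    (congrArg PowerSeries.mk (funext (hw.delta_delta_branchSolution hz))).trans
      (epsSeries_branchTerm w 4 _ z)
  have hA := one_add_epsSeries_branchSolution w z
  have hS := congrArg (branchEval w z) solSeries_equation
  rw [← mul_weightedEuler_weightedEuler_sub_sq] at hS
  have hbranch := congrArg PowerSeries.C (hw.eq z hz)
  have hinv := congrArg PowerSeries.C (inv_mul_cancel₀ (hw.two_mul_sub_one_ne_zero hz))
  rw [hδ, hδδ, hA, eq_sub_of_add_eq' hA]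
  simp only [map_mul, map_add, map_sub, map_pow, map_one, map_ofNat, branchEval_X, branchEval_C,
    aeval_X, div_eq_mul_inv, ← inv_pow] at hS hbranch hinv ⊢
  set S := branchEval w z solSeries
  set S₁ := branchEval w z (weightedEuler (X * (1 - 2 * X)) solSeries)
  set S₂ := branchEval w z (weightedEuler (X * (1 - 2 * X) + 4 * X * (X + 1))
    (weightedEuler (X * (1 - 2 * X)) solSeries))
  linear_combination hS + S ^ 3 * hbranch +
    PowerSeries.X * (1 + PowerSeries.C (w z)) ^ 2 * PowerSeries.C (2 * w z - 1)⁻¹ ^ 4 *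
      (S * S₂ - S₁ ^ 2) * hinv

end IsBranch

theorem IsBranch.isFormalSolution {w : ℂ → ℂ} (hw : IsBranch w) :
    IsFormalSolution (branchSolution w) where
  holomorphic k _ hz :=
    ((hw.hasDerivAt_branchTerm hz 0 _ k).differentiableAt.sub_const _).differentiableWithinAt
  solves _ hz := hw.branchSolution_equation hz

end FormalSolution

section Uniqueness

theorem X_pow_dvd_epsSeries_sub {f g : ℕ → ℂ → ℂ} {n : ℕ} {z : ℂ} (h : ∀ i < n, f i z = g i z) :
    PowerSeries.X ^ n ∣ epsSeries f z - epsSeries g z := by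
  rw [PowerSeries.X_pow_dvd_iff]
  intro i hi
  simp [epsSeries, h i hi]

theorem constantCoeff_epsSeries (f : ℕ → ℂ → ℂ) (z : ℂ) :
    PowerSeries.constantCoeff (epsSeries f z) = f 0 z := by
  rw [← PowerSeries.coeff_zero_eq_constantCoeff_apply, epsSeries, PowerSeries.coeff_mk]

theorem X_pow_dvd_sub_of_X_pow_dvd_cubic_sub {z w : ℂ} (h : z * (1 + w) ^ 3 = w)
    (hw : 2 * w - 1 ≠ 0) {a b : ℂ⟦X⟧} (ha : PowerSeries.constantCoeff a = w)
    (hb : PowerSeries.constantCoeff b = w) {n : ℕ}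
    (hab : PowerSeries.X ^ n ∣ PowerSeries.C z * (1 + a) ^ 3 - a -
      (PowerSeries.C z * (1 + b) ^ 3 - b)) :
    PowerSeries.X ^ n ∣ a - b := by
  set u := PowerSeries.C z * ((1 + a) ^ 2 + (1 + a) * (1 + b) + (1 + b) ^ 2) - 1 with hu
  have hfactor : PowerSeries.C z * (1 + a) ^ 3 - a - (PowerSeries.C z * (1 + b) ^ 3 - b) =
      (a - b) * u := by ring
  have hunit : IsUnit u := by
    rw [PowerSeries.isUnit_iff_constantCoeff, isUnit_iff_ne_zero]
    simp only [hu, map_sub, map_mul, map_add, map_pow, map_one, PowerSeries.constantCoeff_C, ha, hb]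
    intro hzero
    apply hw
    linear_combination (1 + w) * hzero - 3 * h
  rwa [hfactor, hunit.dvd_mul_right] at hab

namespace IsFormalSolution

variable {A B : ℕ → ℂ → ℂ}

theorem isBranch (hA : IsFormalSolution A) : IsBranch (A 0) where
  holomorphic := hA.holomorphic 0
  eq z hz := by
    have h := congrArg PowerSeries.constantCoeff (hA.solves z hz)
    simpa [constantCoeff_epsSeries, sub_eq_zero] using h

theorem X_pow_succ_dvd_sub (hA : IsFormalSolution A) (hB : IsFormalSolution B) {k : ℕ}
    (h : ∀ i < k, ∀ z ∈ disc, A i z = B i z) {z : ℂ} (hz : z ∈ disc) (h₀ : A 0 z = B 0 z) :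
    PowerSeries.X ^ (k + 1) ∣ epsSeries A z - epsSeries B z := by
  refine X_pow_dvd_sub_of_X_pow_dvd_cubic_sub (hB.isBranch.eq z hz)
    (hB.isBranch.two_mul_sub_one_ne_zero hz) (by rw [constantCoeff_epsSeries, h₀])
    (constantCoeff_epsSeries B z) ?_
  obtain ⟨p, hp⟩ := X_pow_dvd_epsSeries_sub fun i hi => h i hi z hz
  obtain ⟨q, hq⟩ := X_pow_dvd_epsSeries_sub fun i hi => delta_congr (h i hi) hz
  obtain ⟨r, hr⟩ := X_pow_dvd_epsSeries_sub fun i hi =>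
    delta_congr (fun x hx => delta_congr (h i hi) hx) hz
  rw [hA.solves z hz, hB.solves z hz, ← mul_sub, pow_succ']
  refine mul_dvd_mul_left _ ⟨p * epsSeries (fun k => delta (delta (A k))) z +
    (1 + epsSeries B z) * r - q * (epsSeries (fun k => delta (A k)) z +
      epsSeries (fun k => delta (B k)) z), ?_⟩
  linear_combination epsSeries (fun k => delta (delta (A k))) z * hp + (1 + epsSeries B z) * hr -
    (epsSeries (fun k => delta (A k)) z + epsSeries (fun k => delta (B k)) z) * hq

theorem eqOn_disc (hA : IsFormalSolution A) (hB : IsFormalSolution B)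
    (h₀ : ∀ z ∈ disc, A 0 z = B 0 z) (k : ℕ) : ∀ z ∈ disc, A k z = B k z := by
  induction k using Nat.strong_induction_on with
  | _ k ih =>
    intro z hz
    simpa only [epsSeries, PowerSeries.coeff_mk] using
      coeff_eq_of_X_pow_dvd_sub (hA.X_pow_succ_dvd_sub hB ih hz (h₀ z hz)) k.lt_succ_self

theorem eq_branchSolution (hA : IsFormalSolution A) (k : ℕ) {z : ℂ} (hz : z ∈ disc) :
    A k z = branchSolution (A 0) k z :=
  hA.eqOn_disc hA.isBranch.isFormalSolution (fun z _ => (branchSolution_zero (A 0) z).symm) k z hz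

end IsFormalSolution

end Uniqueness

section Existence

theorem norm_one_add_pow_le {w : ℂ} (hw : ‖w‖ ≤ 1 / 2) (n : ℕ) : ‖(1 + w) ^ n‖ ≤ (3 / 2) ^ n := by
  rw [norm_pow]
  gcongr
  linarith [norm_add_le 1 w, norm_one (α := ℂ)]

theorem norm_cube_sub_cube_le {v w : ℂ} (hv : ‖v‖ ≤ 1 / 2) (hw : ‖w‖ ≤ 1 / 2) :
    ‖(1 + w) ^ 3 - (1 + v) ^ 3‖ ≤ 27 / 4 * ‖w - v‖ := by
  have hfactor : (1 + w) ^ 3 - (1 + v) ^ 3 =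
      ((1 + w) ^ 2 + (1 + w) ^ 1 * (1 + v) ^ 1 + (1 + v) ^ 2) * (w - v) := by ring
  rw [hfactor, norm_mul]
  refine mul_le_mul_of_nonneg_right ?_ (norm_nonneg _)
  calc ‖(1 + w) ^ 2 + (1 + w) ^ 1 * (1 + v) ^ 1 + (1 + v) ^ 2‖
      ≤ ‖(1 + w) ^ 2‖ + ‖(1 + w) ^ 1‖ * ‖(1 + v) ^ 1‖ + ‖(1 + v) ^ 2‖ := by
        rw [← norm_mul]
        exact norm_add₃_le
    _ ≤ (3 / 2) ^ 2 + (3 / 2) ^ 1 * (3 / 2) ^ 1 + (3 / 2) ^ 2 := by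
        gcongr <;> exact norm_one_add_pow_le ‹_› _
    _ = 27 / 4 := by norm_num

theorem exists_cubic_root {z : ℂ} (hz : z ∈ disc) : ∃ w : ℂ, ‖w‖ ≤ 1 / 2 ∧ z * (1 + w) ^ 3 = w := by
  have hz' := norm_lt_of_mem_disc hz
  have hmaps : Set.MapsTo (fun w : ℂ => z * (1 + w) ^ 3) (Metric.closedBall 0 (1 / 2))
      (Metric.closedBall 0 (1 / 2)) := by
    intro w hw
    rw [mem_closedBall_zero_iff] at hw ⊢
    calc ‖z * (1 + w) ^ 3‖ ≤ 4 / 27 * (3 / 2) ^ 3 := by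
          rw [norm_mul]
          gcongr
          exact norm_one_add_pow_le hw 3
      _ = 1 / 2 := by norm_num
  have hcontr : ContractingWith (Real.toNNReal (27 / 4 * ‖z‖)) (hmaps.restrict _ _ _) := by
    refine ⟨by rw [Real.toNNReal_lt_one]; linarith, LipschitzWith.of_dist_le_mul ?_⟩
    rintro ⟨w, hw⟩ ⟨v, hv⟩
    rw [mem_closedBall_zero_iff] at hw hv
    rw [Real.coe_toNNReal _ (by positivity), Subtype.dist_eq, Subtype.dist_eq, dist_eq_norm,
      dist_eq_norm, Set.MapsTo.val_restrict_apply, Set.MapsTo.val_restrict_apply, ← mul_sub,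
      norm_mul, mul_right_comm, mul_comm]
    gcongr
    exact norm_cube_sub_cube_le hv hw
  obtain ⟨w, hw, hfix, -⟩ := hcontr.exists_fixedPoint' (x := 0)
    Metric.isClosed_closedBall.isComplete hmaps (by simp) (edist_ne_top _ _)
  exact ⟨w, by simpa using hw, hfix⟩

theorem norm_sub_le_of_cubic {z z₀ w w₀ : ℂ} (hz₀ : z₀ ∈ disc) (hw : ‖w‖ ≤ 1 / 2)
    (hw₀ : ‖w₀‖ ≤ 1 / 2) (h : z * (1 + w) ^ 3 = w) (h₀ : z₀ * (1 + w₀) ^ 3 = w₀) :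
    ‖w - w₀‖ ≤ (3 / 2) ^ 3 / (1 - 27 / 4 * ‖z₀‖) * ‖z - z₀‖ := by
  have hz₀' := norm_lt_of_mem_disc hz₀
  have hsplit : w - w₀ = (1 + w) ^ 3 * (z - z₀) + z₀ * ((1 + w) ^ 3 - (1 + w₀) ^ 3) := by
    linear_combination h₀ - h
  have hle : ‖w - w₀‖ ≤ (3 / 2) ^ 3 * ‖z - z₀‖ + ‖z₀‖ * (27 / 4 * ‖w - w₀‖) :=
    calc ‖w - w₀‖ = ‖(1 + w) ^ 3 * (z - z₀) + z₀ * ((1 + w) ^ 3 - (1 + w₀) ^ 3)‖ := by rw [← hsplit]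
      _ ≤ ‖(1 + w) ^ 3‖ * ‖z - z₀‖ + ‖z₀‖ * ‖(1 + w) ^ 3 - (1 + w₀) ^ 3‖ := by
        rw [← norm_mul, ← norm_mul]
        exact norm_add_le _ _
      _ ≤ _ := by
        gcongr
        · exact norm_one_add_pow_le hw 3
        · exact norm_cube_sub_cube_le hw₀ hw
  rw [div_mul_eq_mul_div, le_div_iff₀ (by linarith)]
  linarith

theorem continuousAt_of_cubic {w : ℂ → ℂ} (hnorm : ∀ z ∈ disc, ‖w z‖ ≤ 1 / 2)
    (heq : ∀ z ∈ disc, z * (1 + w z) ^ 3 = w z) {z₀ : ℂ} (hz₀ : z₀ ∈ disc) :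
    ContinuousAt w z₀ := by
  obtain ⟨r, hr, hball⟩ := Metric.isOpen_iff.mp isOpen_disc z₀ hz₀
  refine continuousAt_of_locally_lipschitz hr ((3 / 2) ^ 3 / (1 - 27 / 4 * ‖z₀‖)) fun z hz => ?_
  have hz' := hball hz
  rw [dist_eq_norm, dist_eq_norm]
  exact norm_sub_le_of_cubic hz₀ (hnorm z hz') (hnorm z₀ hz₀) (heq z hz') (heq z₀ hz₀)

theorem differentiableAt_of_cubic {w : ℂ → ℂ} (heq : ∀ z ∈ disc, z * (1 + w z) ^ 3 = w z)
    {z₀ : ℂ} (hz₀ : z₀ ∈ disc) (hcont : ContinuousAt w z₀) : DifferentiableAt ℂ w z₀ := by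
  have hne := one_add_ne_zero_of_eq (heq z₀ hz₀)
  have hinverse : HasDerivAt (fun v : ℂ => v / (1 + v) ^ 3)
      (-(2 * w z₀ - 1) / (1 + w z₀) ^ 4) (w z₀) := by
    refine ((hasDerivAt_id _).div (((hasDerivAt_id _).const_add 1).pow 3)
      (pow_ne_zero 3 hne)).congr_deriv ?_
    simp only [Pi.pow_apply]
    field_simp
    ring
  refine (hinverse.of_local_left_inverse hcont ?_ ?_).differentiableAt
  · exact div_ne_zero (neg_ne_zero.mpr (two_mul_sub_one_ne_zero_of_eq hz₀ (heq z₀ hz₀)))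
      (pow_ne_zero 4 hne)
  · filter_upwards [isOpen_disc.mem_nhds hz₀] with z hz
    rw [div_eq_iff (pow_ne_zero 3 (one_add_ne_zero_of_eq (heq z hz))), heq z hz]

theorem exists_isBranch : ∃ w : ℂ → ℂ, IsBranch w := by
  choose! w hnorm heq using fun (z : ℂ) (hz : z ∈ disc) => exists_cubic_root hz
  exact ⟨w, fun z hz => (differentiableAt_of_cubic heq hz
    (continuousAt_of_cubic hnorm heq hz)).differentiableWithinAt, heq⟩

end Existence

section WeightedMean

variable {weight : ℕ × ℕ → ℝ}

theorem tendsto_sum_antidiagonal_mul_zero (h₀ : ∀ p, 0 ≤ weight p)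
    (h₁ : ∀ n, ∑ p ∈ Finset.HasAntidiagonal.antidiagonal n, weight p = 1)
    (hlim : ∀ i, Tendsto (fun j => weight (i, j)) atTop (nhds 0)) {u : ℕ → ℝ}
    (hu : Tendsto u atTop (nhds 0)) :
    Tendsto (fun n => ∑ p ∈ Finset.HasAntidiagonal.antidiagonal n, weight p * u p.1)
      atTop (nhds 0) := by
  rw [Metric.tendsto_atTop]
  intro η hη
  obtain ⟨N, hN⟩ := Metric.tendsto_atTop.mp hu (η / 2) (half_pos hη)
  have hhead : Tendsto (fun n => ∑ i ∈ Finset.range N, weight (i, n - i) * |u i|)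
      atTop (nhds 0) := by
    simpa using tendsto_finsetSum (Finset.range N) fun i _ =>
      ((hlim i).comp (tendsto_sub_atTop_nat i)).mul_const |u i|
  obtain ⟨M, hM⟩ := Metric.tendsto_atTop.mp hhead (η / 2) (half_pos hη)
  refine ⟨max M N, fun n hn => ?_⟩
  have hhead_n := hM n (le_of_max_le_left hn)
  rw [Real.dist_eq, sub_zero] at hhead_n ⊢
  have hterm (p : ℕ × ℕ) : |weight p * u p.1| ≤
      weight p * (η / 2) + if p.1 < N then weight p * |u p.1| else 0 := by
    rw [abs_mul, abs_of_nonneg (h₀ p)]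
    split_ifs with hp
    · linarith [mul_nonneg (h₀ p) (half_pos hη).le]
    · have hp' := hN p.1 (not_lt.mp hp)
      rw [Real.dist_eq, sub_zero] at hp'
      linarith [mul_le_mul_of_nonneg_left hp'.le (h₀ p)]
  calc |∑ p ∈ Finset.HasAntidiagonal.antidiagonal n, weight p * u p.1|
      ≤ ∑ p ∈ Finset.HasAntidiagonal.antidiagonal n,
          (weight p * (η / 2) + if p.1 < N then weight p * |u p.1| else 0) :=
        (Finset.abs_sum_le_sum_abs _ _).trans (Finset.sum_le_sum fun p _ => hterm p)
    _ = η / 2 + ∑ i ∈ Finset.range N, weight (i, n - i) * |u i| := by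
        rw [Finset.sum_add_distrib, ← Finset.sum_mul, h₁, one_mul,
          Finset.Nat.sum_antidiagonal_eq_sum_range_succ
            (fun i j => if i < N then weight (i, j) * |u i| else 0), ← Finset.sum_filter,
          show (Finset.range n.succ).filter (· < N) = Finset.range N by grind]
    _ < η := by linarith [le_abs_self (∑ i ∈ Finset.range N, weight (i, n - i) * |u i|)]

theorem tendsto_sum_antidiagonal_mul_mul (h₀ : ∀ p, 0 ≤ weight p)
    (h₁ : ∀ n, ∑ p ∈ Finset.HasAntidiagonal.antidiagonal n, weight p = 1)
    (hfst : ∀ i, Tendsto (fun j => weight (i, j)) atTop (nhds 0))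
    (hsnd : ∀ j, Tendsto (fun i => weight (i, j)) atTop (nhds 0)) {f g : ℕ → ℂ} {c d : ℂ}
    (hf : Tendsto f atTop (nhds c)) (hg : Tendsto g atTop (nhds d)) :
    Tendsto (fun n => ∑ p ∈ Finset.HasAntidiagonal.antidiagonal n, weight p * (f p.1 * g p.2))
      atTop (nhds (c * d)) := by
  obtain ⟨M, hM⟩ : ∃ M, ∀ n, ‖g n‖ ≤ M :=
    hg.norm.bddAbove_range.imp fun M hM n => hM (Set.mem_range_self n)
  have hmeanf := (tendsto_sum_antidiagonal_mul_zero h₀ h₁ hfst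
    (tendsto_iff_norm_sub_tendsto_zero.mp hf)).const_mul M
  have hmeang := (tendsto_sum_antidiagonal_mul_zero (weight := weight ∘ Prod.swap)
    (fun p => h₀ p.swap) (fun n => (Finset.Nat.sum_antidiagonal_swap (f := weight)).trans (h₁ n))
    hsnd (tendsto_iff_norm_sub_tendsto_zero.mp hg)).const_mul ‖c‖
  rw [tendsto_iff_norm_sub_tendsto_zero]
  refine squeeze_zero (fun _ => norm_nonneg _) (fun n => ?_)
    (by simpa only [mul_zero, add_zero] using hmeanf.add hmeang)
  have hcd : c * d = ∑ p ∈ Finset.HasAntidiagonal.antidiagonal n, (weight p : ℂ) * (c * d) := by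
    rw [← Finset.sum_mul, ← Complex.ofReal_sum, h₁, Complex.ofReal_one, one_mul]
  have hswap : ∑ p ∈ Finset.HasAntidiagonal.antidiagonal n,
      (weight ∘ Prod.swap) p * ‖g p.1 - d‖ =
      ∑ p ∈ Finset.HasAntidiagonal.antidiagonal n, weight p * ‖g p.2 - d‖ :=
    Finset.Nat.sum_antidiagonal_swap (f := fun p => weight p * ‖g p.2 - d‖)
  rw [hcd, ← Finset.sum_sub_distrib, hswap, Finset.mul_sum, Finset.mul_sum,
    ← Finset.sum_add_distrib]
  refine (norm_sum_le _ _).trans (Finset.sum_le_sum fun p _ => ?_)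
  calc ‖(weight p : ℂ) * (f p.1 * g p.2) - weight p * (c * d)‖
      = weight p * ‖(f p.1 - c) * g p.2 + c * (g p.2 - d)‖ := by
        rw [← mul_sub, norm_mul, Complex.norm_of_nonneg (h₀ p)]
        ring_nf
    _ ≤ weight p * (‖f p.1 - c‖ * M + ‖c‖ * ‖g p.2 - d‖) := by
        refine mul_le_mul_of_nonneg_left ((norm_add_le _ _).trans ?_) (h₀ p)
        rw [norm_mul, norm_mul]
        gcongr
        exact hM p.2
    _ = M * (weight p * ‖f p.1 - c‖) + ‖c‖ * (weight p * ‖g p.2 - d‖) := by ring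

end WeightedMean

section Multichoose

variable {α β : ℝ}

theorem multichoose_eq_prod_div (α : ℝ) (n : ℕ) :
    Ring.multichoose α n = (∏ j ∈ Finset.range n, (α + j)) / n.factorial := by
  rw [eq_div_iff (by positivity), mul_comm, ← nsmul_eq_mul,
    Ring.factorial_nsmul_multichoose_eq_ascPochhammer, Polynomial.ascPochhammer_smeval_eq_eval]
  induction n with
  | zero => simp
  | succ n ih => rw [ascPochhammer_succ_eval, Finset.prod_range_succ, ih]

theorem multichoose_pos (hα : 0 < α) (n : ℕ) : 0 < Ring.multichoose α n := by
  rw [multichoose_eq_prod_div]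
  positivity

theorem sum_antidiagonal_multichoose_mul (α β : ℝ) (n : ℕ) :
    ∑ p ∈ Finset.HasAntidiagonal.antidiagonal n, Ring.multichoose α p.1 * Ring.multichoose β p.2 =
      Ring.multichoose (α + β) n := by
  have hneg (r : ℝ) (k : ℕ) : Ring.multichoose r k = (-1) ^ k * Ring.choose (-r) k := by
    simp [Ring.choose_neg', Int.negOnePow_def, Units.smul_def, ← mul_assoc, ← mul_pow]
  rw [hneg, neg_add, Ring.add_choose_eq n (Commute.all _ _), Finset.mul_sum]
  refine Finset.sum_congr rfl fun p hp => ?_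
  rw [hneg, hneg, ← Finset.HasAntidiagonal.mem_antidiagonal.mp hp, pow_add]
  ring

theorem tendsto_multichoose_mul_rpow (hα : 0 < α) :
    Tendsto (fun n : ℕ => Ring.multichoose α n * (n : ℝ) ^ (1 - α)) atTop
      (nhds (1 / Real.Gamma α)) := by
  have hratio : Tendsto (fun n : ℕ => (n : ℝ) / (n + α)) atTop (nhds 1) :=
    tendsto_natCast_div_add_atTop α
  refine (hratio.div (Real.GammaSeq_tendsto_Gamma α) (Real.Gamma_pos_of_pos hα).ne').congr' ?_
  filter_upwards [eventually_gt_atTop 0] with n hn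
  have hn' : (0 : ℝ) < n := by exact_mod_cast hn
  have hprod : (∏ j ∈ Finset.range n, (α + j)) ≠ 0 := by positivity
  rw [Pi.div_apply, Real.GammaSeq, multichoose_eq_prod_div, Finset.prod_range_succ,
    Real.rpow_sub hn', Real.rpow_one]
  field_simp
  ring

theorem tendsto_multichoose_div_multichoose (hβ : 0 < β) (h : β < α) :
    Tendsto (fun n => Ring.multichoose β n / Ring.multichoose α n) atTop (nhds 0) := by
  have hα := hβ.trans h
  have hratio := (tendsto_multichoose_mul_rpow hβ).div (tendsto_multichoose_mul_rpow hα)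
    (one_div_ne_zero (Real.Gamma_pos_of_pos hα).ne')
  have hpow := (tendsto_rpow_neg_atTop (sub_pos.mpr h)).comp tendsto_natCast_atTop_atTop
  have hmul := hratio.mul hpow
  rw [mul_zero] at hmul
  refine hmul.congr' ?_
  filter_upwards [eventually_gt_atTop 0] with n hn
  have hn' : (0 : ℝ) < n := by exact_mod_cast hn
  have hpow_ne (s : ℝ) : (n : ℝ) ^ s ≠ 0 := (Real.rpow_pos_of_pos hn' s).ne'
  rw [Pi.div_apply, Function.comp_apply, show -(α - β) = (1 - α) - (1 - β) by ring,
    Real.rpow_sub hn' (1 - α), mul_div_mul_comm, mul_assoc, div_mul_div_cancel₀ (hpow_ne _),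
    div_self (hpow_ne _), mul_one]

theorem tendsto_multichoose_div_multichoose_succ (hα : 0 < α) :
    Tendsto (fun n => Ring.multichoose α n / Ring.multichoose α (n + 1)) atTop (nhds 1) := by
  have h := (tendsto_natCast_div_add_atTop α).div (tendsto_natCast_div_add_atTop (1 : ℝ))
    one_ne_zero
  rw [div_one] at h
  refine h.congr' ?_
  filter_upwards [eventually_gt_atTop 0] with n hn
  rw [Pi.div_apply, multichoose_eq_prod_div, multichoose_eq_prod_div, Finset.prod_range_succ,
    Nat.factorial_succ]
  push_cast
  field_simp
  ring

theorem tendsto_multichoose_div_multichoose_add (hα : 0 < α) (i : ℕ) :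
    Tendsto (fun n => Ring.multichoose α n / Ring.multichoose α (i + n)) atTop (nhds 1) := by
  induction i with
  | zero => simp [div_self (multichoose_pos hα _).ne']
  | succ i ih =>
    have h := ih.mul ((tendsto_multichoose_div_multichoose_succ hα).comp
      (tendsto_add_atTop_nat i))
    rw [mul_one] at h
    refine h.congr fun n => ?_
    rw [Function.comp_apply, add_comm n i, div_mul_div_cancel₀ (multichoose_pos hα _).ne',
      Nat.add_right_comm]

theorem tendsto_multichoose_mul_div_multichoose (hα : 0 < α) (hβ : 0 < β) (i : ℕ) :
    Tendsto (fun j => Ring.multichoose α i * Ring.multichoose β j /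
      Ring.multichoose (α + β) (i + j)) atTop (nhds 0) := by
  have hγ := add_pos hα hβ
  have h := ((tendsto_multichoose_div_multichoose hβ (lt_add_of_pos_left β hα)).mul
    (tendsto_multichoose_div_multichoose_add hγ i)).const_mul (Ring.multichoose α i)
  rw [zero_mul, mul_zero] at h
  refine h.congr fun j => ?_
  have := (multichoose_pos hγ j).ne'
  field_simp

end Multichoose

section Euler

/-- The Euler operator `X d/dX` on formal power series in `z`, the formal counterpart of `delta`. -/
def euler : Derivation ℂ ℂ⟦X⟧ ℂ⟦X⟧ := (PowerSeries.X : ℂ⟦X⟧) • d⁄dX ℂ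

theorem euler_apply (F : ℂ⟦X⟧) : euler F = PowerSeries.X * d⁄dX ℂ F := rfl

theorem euler_X : euler PowerSeries.X = PowerSeries.X := by
  rw [euler_apply, PowerSeries.derivative_X, mul_one]

theorem euler_ofNat (m : ℕ) [m.AtLeastTwo] : euler (ofNat(m) : ℂ⟦X⟧) = 0 :=
  euler.map_natCast m

theorem coeff_euler (n : ℕ) (F : ℂ⟦X⟧) :
    PowerSeries.coeff n (euler F) = n * PowerSeries.coeff n F := by
  rw [euler_apply]
  cases n with
  | zero => simp
  | succ n =>
    rw [PowerSeries.coeff_succ_X_mul, PowerSeries.coeff_derivative, Nat.cast_succ, mul_comm]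

end Euler

section CoeffAsymp

/-- The coefficients of `F` grow like those of `c (1 - z / ρ) ^ (-α)`, that is
`[zⁿ] F = (c / Γ(α) + o(1)) n ^ (α - 1) ρ⁻ⁿ`.  If `α` is a pole of `Γ`, then `c / Γ(α) = 0`, as it
should be, since `(1 - z / ρ) ^ (-α)` is then a polynomial. -/
def CoeffAsymp (ρ : ℂ) (F : ℂ⟦X⟧) (α : ℝ) (c : ℂ) : Prop :=
  Tendsto (fun n : ℕ => PowerSeries.coeff n F * ρ ^ n * ((n : ℝ) ^ (1 - α) : ℝ)) atTop
    (nhds (c / (Real.Gamma α : ℂ)))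

namespace CoeffAsymp

variable {ρ : ℂ} {F G : ℂ⟦X⟧} {α β : ℝ} {c d : ℂ}

theorem add (hF : CoeffAsymp ρ F α c) (hG : CoeffAsymp ρ G α d) :
    CoeffAsymp ρ (F + G) α (c + d) := by
  rw [CoeffAsymp, add_div]
  refine (Tendsto.add hF hG).congr fun n => ?_
  rw [map_add]
  ring

theorem C_mul (a : ℂ) (hF : CoeffAsymp ρ F α c) :
    CoeffAsymp ρ (PowerSeries.C a * F) α (a * c) := by
  rw [CoeffAsymp, mul_div_assoc]
  refine (Tendsto.const_mul a hF).congr fun n => ?_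
  rw [PowerSeries.coeff_C_mul]
  ring

theorem of_eventually_coeff_eq_zero (h : ∀ᶠ n in atTop, PowerSeries.coeff n F = 0)
    (hc : c / (Real.Gamma α : ℂ) = 0) : CoeffAsymp ρ F α c := by
  rw [CoeffAsymp, hc]
  refine tendsto_const_nhds.congr' ?_
  filter_upwards [h] with n hn
  simp [hn]

theorem of_C (ρ a : ℂ) (hc : c / (Real.Gamma α : ℂ) = 0) :
    CoeffAsymp ρ (PowerSeries.C a) α c := by
  refine of_eventually_coeff_eq_zero ?_ hc
  filter_upwards [eventually_ne_atTop 0] with n hn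
  rw [PowerSeries.coeff_C, if_neg hn]

theorem of_lt (hF : CoeffAsymp ρ F α c) (h : α < β) : CoeffAsymp ρ F β 0 := by
  have hpow : Tendsto (fun n : ℕ => (((n : ℝ) ^ (-(β - α)) : ℝ) : ℂ)) atTop (nhds ((0 : ℝ) : ℂ)) :=
    (Complex.continuous_ofReal.tendsto 0).comp
      ((tendsto_rpow_neg_atTop (sub_pos.mpr h)).comp tendsto_natCast_atTop_atTop)
  have hmul := Tendsto.mul hF hpow
  rw [Complex.ofReal_zero, mul_zero] at hmul
  rw [CoeffAsymp, zero_div]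
  refine hmul.congr' ?_
  filter_upwards [eventually_gt_atTop 0] with n hn
  rw [mul_assoc, ← Complex.ofReal_mul, ← Real.rpow_add (by exact_mod_cast hn)]
  congr 3
  ring

theorem iff_tendsto_div_multichoose (hα : 0 < α) : CoeffAsymp ρ F α c ↔
    Tendsto (fun n => PowerSeries.coeff n F * ρ ^ n / (Ring.multichoose α n : ℝ)) atTop
      (nhds c) := by
  have hΓ : (Real.Gamma α : ℂ) ≠ 0 := by exact_mod_cast (Real.Gamma_pos_of_pos hα).ne'
  have hweight : Tendsto (fun n : ℕ => ((Ring.multichoose α n * (n : ℝ) ^ (1 - α) : ℝ) : ℂ)) atTop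
      (nhds (1 / (Real.Gamma α : ℂ))) := by
    exact_mod_cast (Complex.continuous_ofReal.tendsto _).comp (tendsto_multichoose_mul_rpow hα)
  constructor <;> intro h
  · have hdiv := Tendsto.div h hweight (one_div_ne_zero hΓ)
    rw [div_div_div_cancel_right₀ hΓ, div_one] at hdiv
    refine hdiv.congr' ?_
    filter_upwards [eventually_gt_atTop 0] with n hn
    have hpow : (((n : ℝ) ^ (1 - α) : ℝ) : ℂ) ≠ 0 := by
      exact_mod_cast (Real.rpow_pos_of_pos (by exact_mod_cast hn) (1 - α)).ne'
    rw [Pi.div_apply, Complex.ofReal_mul, mul_div_mul_right _ _ hpow]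
  · have hmul := h.mul hweight
    rw [mul_one_div] at hmul
    refine hmul.congr fun n => ?_
    have hne : ((Ring.multichoose α n : ℝ) : ℂ) ≠ 0 := by exact_mod_cast (multichoose_pos hα n).ne'
    rw [Complex.ofReal_mul, ← mul_assoc, div_mul_cancel₀ _ hne]

theorem mul (hα : 0 < α) (hβ : 0 < β) (hF : CoeffAsymp ρ F α c) (hG : CoeffAsymp ρ G β d) :
    CoeffAsymp ρ (F * G) (α + β) (c * d) := by
  rw [iff_tendsto_div_multichoose hα] at hF
  rw [iff_tendsto_div_multichoose hβ] at hG
  rw [iff_tendsto_div_multichoose (add_pos hα hβ)]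
  set weight : ℕ × ℕ → ℝ := fun p => Ring.multichoose α p.1 * Ring.multichoose β p.2 /
    Ring.multichoose (α + β) (p.1 + p.2) with hweight
  have hpα (n : ℕ) := multichoose_pos hα n
  have hpβ (n : ℕ) := multichoose_pos hβ n
  have hpαβ (n : ℕ) := multichoose_pos (add_pos hα hβ) n
  have hsum (n : ℕ) : ∑ p ∈ Finset.HasAntidiagonal.antidiagonal n, weight p = 1 := by
    rw [← div_self (hpαβ n).ne', ← sum_antidiagonal_multichoose_mul, Finset.sum_div]
    refine Finset.sum_congr rfl fun p hp => ?_
    simp only [hweight, Finset.HasAntidiagonal.mem_antidiagonal.mp hp,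
      sum_antidiagonal_multichoose_mul]
  have hsnd (j : ℕ) : Tendsto (fun i => weight (i, j)) atTop (nhds 0) :=
    (tendsto_multichoose_mul_div_multichoose hβ hα j).congr fun i => by
      simp only [hweight]
      rw [add_comm β, add_comm j, mul_comm]
  refine (tendsto_sum_antidiagonal_mul_mul
    (fun p => div_nonneg (mul_pos (hpα _) (hpβ _)).le (hpαβ _).le) hsum
    (tendsto_multichoose_mul_div_multichoose hα hβ) hsnd hF hG).congr fun n => ?_
  rw [PowerSeries.coeff_mul, Finset.sum_mul, Finset.sum_div]
  refine Finset.sum_congr rfl fun p hp => ?_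
  have hpα' : ((Ring.multichoose α p.1 : ℝ) : ℂ) ≠ 0 := by exact_mod_cast (hpα _).ne'
  have hpβ' : ((Ring.multichoose β p.2 : ℝ) : ℂ) ≠ 0 := by exact_mod_cast (hpβ _).ne'
  rw [← Finset.HasAntidiagonal.mem_antidiagonal.mp hp, pow_add]
  push_cast
  field_simp

theorem pow (hα : 0 < α) (hF : CoeffAsymp ρ F α c) (m : ℕ) :
    CoeffAsymp ρ (F ^ m) (m * α) (c ^ m) := by
  induction m with
  | zero => simpa using of_C ρ 1 (by simp)
  | succ m ih =>
    rcases m.eq_zero_or_pos with rfl | hm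
    · simpa using hF
    · rw [pow_succ, pow_succ, Nat.cast_succ, add_one_mul]
      exact ih.mul (by positivity) hα hF

theorem of_euler_add {a : ℂ} (hα : α ≠ 0)
    (h : CoeffAsymp ρ (euler F + PowerSeries.C a * F) (α + 1) (α * c)) :
    CoeffAsymp ρ F α c := by
  have hratio : Tendsto (fun n : ℕ => (n : ℂ) / (n + a)) atTop (nhds 1) :=
    tendsto_natCast_div_add_atTop a
  have hmul := Tendsto.mul h hratio
  rw [mul_one, Real.Gamma_add_one hα, Complex.ofReal_mul,
    mul_div_mul_left _ _ (by exact_mod_cast hα)] at hmul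
  refine hmul.congr' ?_
  filter_upwards [eventually_gt_atTop 0, hratio.eventually_ne one_ne_zero] with n hn hna
  have hpow : (n : ℝ) ^ (1 - α) = n ^ (1 - (α + 1)) * n := by
    rw [← Real.rpow_add_one (by exact_mod_cast hn.ne')]
    congr 1
    ring
  have hna' : (n : ℂ) + a ≠ 0 := (div_ne_zero_iff.mp hna).2
  rw [map_add, coeff_euler, PowerSeries.coeff_C_mul, ← add_mul, hpow]
  push_cast
  field_simp

theorem isEquivalent {c : ℝ} (hF : CoeffAsymp ρ F α c) (hc : c / Real.Gamma α ≠ 0) :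
    (fun n => PowerSeries.coeff n F) ~[atTop]
      (fun n : ℕ => ((c / Real.Gamma α * (n : ℝ) ^ (α - 1) : ℝ) : ℂ) * ρ⁻¹ ^ n) := by
  have hc' : (c : ℂ) / (Real.Gamma α : ℂ) ≠ 0 := by exact_mod_cast hc
  have h := Tendsto.div_const hF ((c : ℂ) / (Real.Gamma α : ℂ))
  rw [div_self hc'] at h
  refine isEquivalent_of_tendsto_one (h.congr fun n => ?_)
  have hpow : (n : ℝ) ^ (1 - α) = ((n : ℝ) ^ (α - 1))⁻¹ := by
    rw [← Real.rpow_neg n.cast_nonneg, neg_sub]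
  rw [Pi.div_apply, hpow]
  push_cast
  rw [inv_pow]
  simp only [div_eq_mul_inv, mul_inv, inv_inv]
  ring

end CoeffAsymp

end CoeffAsymp

section AlgebraicBranch

variable {W V : ℂ⟦X⟧} (hW : PowerSeries.X * (1 + W) ^ 3 = W) (hV : V * (1 - 2 * W) = 1)

include hW hV

theorem euler_eq_mul_mul : euler W = W * (1 + W) * V := by
  have h := congrArg euler hW
  simp only [Derivation.leibniz, Derivation.leibniz_pow, map_add, Derivation.map_one_eq_zero,
    zero_add, euler_X, smul_eq_mul, nsmul_eq_mul, Nat.cast_ofNat, Nat.reduceSub] at h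
  linear_combination -(1 + W) * V * h + (V * (1 + W) + 3 * V * euler W) * hW - euler W * hV

theorem euler_inv_eq : euler V = 2 * W * (1 + W) * V ^ 3 := by
  have h := congrArg euler hV
  simp only [Derivation.leibniz, map_sub, Derivation.map_one_eq_zero, euler_ofNat,
    zero_sub, smul_eq_mul, euler_eq_mul_mul hW hV] at h
  linear_combination V * h - euler V * hV

theorem euler_one_add_mul : euler ((1 + W) * V) = 3 * W * (1 + W) * V ^ 3 := by
  simp only [Derivation.leibniz, map_add, Derivation.map_one_eq_zero, zero_add, smul_eq_mul,
    euler_eq_mul_mul hW hV, euler_inv_eq hW hV]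
  linear_combination -W * (1 + W) * V ^ 2 * hV

theorem euler_euler_one_add_mul : euler (euler ((1 + W) * V)) =
    3 * W * (1 + W) * V ^ 4 * (1 + 2 * W + 6 * W * (1 + W) * V) := by
  rw [euler_one_add_mul hW hV]
  simp only [Derivation.leibniz, Derivation.leibniz_pow, map_add, Derivation.map_one_eq_zero,
    euler_ofNat, zero_add, smul_eq_mul, nsmul_eq_mul, euler_eq_mul_mul hW hV,
    euler_inv_eq hW hV]
  push_cast
  ring

theorem euler_equation_one_add_mul :
    4 * euler (euler ((1 + W) * V)) - 2 * euler ((1 + W) * V) =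
      PowerSeries.X * (27 * euler (euler ((1 + W) * V)) + 27 * euler ((1 + W) * V) +
        6 * ((1 + W) * V)) := by
  rw [euler_euler_one_add_mul hW hV, euler_one_add_mul hW hV]
  grind

end AlgebraicBranch

section BranchAsymptotics

variable {W V : ℂ⟦X⟧} (hW : PowerSeries.X * (1 + W) ^ 3 = W) (hV : V * (1 - 2 * W) = 1)

theorem multichoose_succ (α : ℝ) (n : ℕ) :
    Ring.multichoose α (n + 1) = Ring.multichoose α n * ((α + n) / (n + 1)) := by
  rw [multichoose_eq_prod_div, multichoose_eq_prod_div, Finset.prod_range_succ,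
    Nat.factorial_succ]
  push_cast
  field_simp

theorem gamma_one_third_mul_gamma_two_thirds :
    Real.Gamma (1 / 3) * Real.Gamma (2 / 3) = 2 * Real.pi / √3 := by
  have h := Real.Gamma_mul_Gamma_one_sub (1 / 3)
  rw [mul_one_div, Real.sin_pi_div_three] at h
  rw [show (2 / 3 : ℝ) = 1 - 1 / 3 by norm_num, h]
  field_simp

theorem two_mul_C_one_half : 2 * PowerSeries.C (1 / 2 : ℂ) = 1 := by
  rw [← map_ofNat PowerSeries.C, ← map_mul]
  norm_num

include hW hV

theorem coeff_succ_one_add_mul (n : ℕ) :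
    2 * ((n : ℂ) + 1) * (2 * n + 1) * PowerSeries.coeff (n + 1) ((1 + W) * V) =
      3 * (3 * n + 1) * (3 * n + 2) * PowerSeries.coeff n ((1 + W) * V) := by
  have h := congrArg (PowerSeries.coeff (n + 1)) (euler_equation_one_add_mul hW hV)
  simp only [← map_ofNat (PowerSeries.C (R := ℂ)), PowerSeries.coeff_succ_X_mul, map_add, map_sub,
    PowerSeries.coeff_C_mul, coeff_euler, Nat.cast_succ] at h
  linear_combination h

theorem constantCoeff_one_add_mul : PowerSeries.constantCoeff ((1 + W) * V) = 1 := by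
  have hW₀ : PowerSeries.constantCoeff W = 0 := by rw [← hW]; simp
  have hV₀ := congrArg PowerSeries.constantCoeff hV
  simp only [map_mul, map_sub, map_one, hW₀, mul_zero, sub_zero, mul_one] at hV₀
  simp [hW₀, hV₀]

/-- Both sides are `Nat.choose (3 * n) n * (4 / 27) ^ n`. -/
theorem coeff_one_add_mul (n : ℕ) : PowerSeries.coeff n ((1 + W) * V) * (4 / 27) ^ n =
    ((Ring.multichoose (1 / 3 : ℝ) n * Ring.multichoose (2 / 3 : ℝ) n /
      Ring.multichoose (1 / 2 : ℝ) n : ℝ) : ℂ) := by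
  induction n with
  | zero => simp [constantCoeff_one_add_mul hW hV]
  | succ n ih =>
    have hne : (2 : ℂ) * n + 1 ≠ 0 := by exact_mod_cast (2 * n).succ_ne_zero
    have hne' : (n : ℂ) + 1 ≠ 0 := by exact_mod_cast n.succ_ne_zero
    have hrec : PowerSeries.coeff (n + 1) ((1 + W) * V) =
        3 * (3 * (n : ℂ) + 1) * (3 * n + 2) / (2 * (n + 1) * (2 * n + 1)) *
          PowerSeries.coeff n ((1 + W) * V) := by
      rw [div_mul_eq_mul_div, eq_div_iff (mul_ne_zero (mul_ne_zero two_ne_zero hne') hne)]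
      linear_combination coeff_succ_one_add_mul hW hV n
    have hratio : (1 / 3 + n : ℂ) / (n + 1) * ((2 / 3 + n) / (n + 1)) / ((1 / 2 + n) / (n + 1)) =
        3 * (3 * n + 1) * (3 * n + 2) / (2 * (n + 1) * (2 * n + 1)) * (4 / 27) := by
      field_simp
      ring
    rw [multichoose_succ, multichoose_succ, multichoose_succ, mul_mul_mul_comm,
      mul_div_mul_comm, Complex.ofReal_mul, ← ih, hrec]
    push_cast
    rw [hratio]
    ring

theorem coeffAsymp_one_add_mul :
    CoeffAsymp (4 / 27) ((1 + W) * V) (1 / 2) ((√3 / 2 : ℝ) : ℂ) := by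
  have h := ((tendsto_multichoose_mul_rpow (α := 1 / 3) (by norm_num)).mul
    (tendsto_multichoose_mul_rpow (α := 2 / 3) (by norm_num))).div
    (tendsto_multichoose_mul_rpow (α := 1 / 2) (by norm_num))
    (one_div_ne_zero (Real.Gamma_pos_of_pos (by norm_num)).ne')
  have hconst : 1 / Real.Gamma (1 / 3) * (1 / Real.Gamma (2 / 3)) / (1 / Real.Gamma (1 / 2)) =
      √3 / 2 / Real.Gamma (1 / 2) := by
    rw [one_div_mul_one_div, gamma_one_third_mul_gamma_two_thirds, Real.Gamma_one_half_eq,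
      one_div_div, div_div_div_eq, mul_one, div_div, div_eq_div_iff (by positivity) (by positivity)]
    linear_combination 2 * √3 * Real.mul_self_sqrt Real.pi_pos.le
  rw [hconst] at h
  rw [CoeffAsymp, ← Complex.ofReal_div]
  refine ((Complex.continuous_ofReal.tendsto _).comp h).congr' ?_
  filter_upwards [eventually_gt_atTop 0] with n hn
  have hn' : (0 : ℝ) < n := by exact_mod_cast hn
  rw [coeff_one_add_mul hW hV, Function.comp_apply, ← Complex.ofReal_mul, Pi.div_apply]
  congr 1
  have hpow : (n : ℝ) ^ (1 - 1 / 3 : ℝ) * n ^ (1 - 2 / 3 : ℝ) =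
      n ^ (1 - 1 / 2 : ℝ) * n ^ (1 - 1 / 2 : ℝ) := by
    rw [← Real.rpow_add hn', ← Real.rpow_add hn']
    norm_num
  have hne := (Real.rpow_pos_of_pos hn' (1 - 1 / 2)).ne'
  rw [mul_mul_mul_comm, hpow, ← mul_assoc, mul_div_mul_right _ _ hne, div_mul_eq_mul_div]

theorem coeffAsymp_inv : CoeffAsymp (4 / 27) V (1 / 2) (((√3)⁻¹ : ℝ) : ℂ) := by
  have h := ((coeffAsymp_one_add_mul hW hV).C_mul (2 / 3)).add
    (CoeffAsymp.of_C (α := 1 / 2) (c := 0) (4 / 27) (1 / 3) (zero_div _))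
  have hinv : 3 * PowerSeries.C (1 / 3 : ℂ) = 1 := by
    rw [← map_ofNat PowerSeries.C, ← map_mul]
    norm_num
  convert h using 1
  · rw [show (2 / 3 : ℂ) = 2 * (1 / 3) by norm_num, map_mul, map_ofNat]
    linear_combination PowerSeries.C (1 / 3) * hV - V * hinv
  · rw [add_zero, ← Real.sqrt_div_self]
    push_cast
    ring

theorem coeffAsymp_branch : CoeffAsymp (4 / 27) W (-(1 / 2)) ((-(√3 / 2) : ℝ) : ℂ) := by
  have h := ((coeffAsymp_inv hW hV).add
    (CoeffAsymp.of_C (α := 1 / 2) (c := 0) (4 / 27) (-1) (zero_div _))).C_mul (3 / 4)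
  refine CoeffAsymp.of_euler_add (a := 1 / 2) (by norm_num) ?_
  convert h using 1
  · rw [show (3 / 4 : ℂ) = 3 * (1 / 2) * (1 / 2) by norm_num, euler_eq_mul_mul hW hV]
    simp only [map_mul, map_ofNat, map_neg, map_one]
    linear_combination -(3 + 2 * W) * PowerSeries.C (1 / 2) ^ 2 * hV -
      (W * (1 + W) * V * (1 + 2 * PowerSeries.C (1 / 2)) + PowerSeries.C (1 / 2) * W) *
        two_mul_C_one_half
  · norm_num
  · rw [add_zero, ← Real.sqrt_div_self]
    push_cast
    ring

theorem coeffAsymp_aeval_mul_pow (m : ℕ) {G : ℂ[X]} (hG : G.natDegree ≤ m + 1) :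
    CoeffAsymp (4 / 27) (aeval W G * V ^ m) (m * (1 / 2))
      (G.eval (1 / 2) * ((√3)⁻¹ : ℝ) ^ m) := by
  induction m generalizing G with
  | zero =>
    have h := (((coeffAsymp_branch hW hV).of_lt (β := 0) (by norm_num)).C_mul (G.coeff 1)).add
      (CoeffAsymp.of_C (α := 0) (c := G.eval (1 / 2)) (4 / 27) (G.coeff 0) (by simp))
    have hlin : aeval W G = PowerSeries.C (G.coeff 1) * W + PowerSeries.C (G.coeff 0) := by
      nth_rewrite 1 [eq_X_add_C_of_natDegree_le_one hG]
      simp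
    simpa [hlin] using h
  | succ m ih =>
    set H := G /ₘ (X - C (1 / 2))
    have hH : H.natDegree ≤ m + 1 := by
      rw [natDegree_divByMonic _ (monic_X_sub_C _), natDegree_X_sub_C]
      omega
    have hGH : G = C (G.eval (1 / 2)) + (X - C (1 / 2)) * H := by
      rw [X_sub_C_mul_divByMonic_eq_sub_modByMonic, modByMonic_X_sub_C_eq_C_eval, add_sub_cancel]
    have h := (((coeffAsymp_inv hW hV).pow (by norm_num) (m + 1)).C_mul (G.eval (1 / 2))).add
      (((ih hH).of_lt (β := (m + 1 : ℕ) * (1 / 2)) (by push_cast; linarith)).C_mul (-(1 / 2)))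
    rw [mul_zero, add_zero] at h
    convert h using 1
    nth_rewrite 1 [hGH]
    simp only [map_add, map_mul, map_sub, aeval_C, aeval_X, PowerSeries.algebraMap_apply,
      Algebra.algebraMap_self, RingHom.id_apply, map_neg]
    linear_combination -(aeval W H * V ^ m * PowerSeries.C (1 / 2)) * hV -
      W * aeval W H * V ^ (m + 1) * two_mul_C_one_half

end BranchAsymptotics

section TaylorSeries

variable {f g : ℂ → ℂ}

/-- The Taylor series of `f` at the origin. -/
def taylorSeries (f : ℂ → ℂ) : ℂ⟦X⟧ := PowerSeries.mk fun n => iteratedDeriv n f 0 / n.factorial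

theorem coeff_taylorSeries (f : ℂ → ℂ) (n : ℕ) :
    PowerSeries.coeff n (taylorSeries f) = iteratedDeriv n f 0 / n.factorial :=
  PowerSeries.coeff_mk _ _

theorem taylorSeries_congr (h : f =ᶠ[nhds 0] g) : taylorSeries f = taylorSeries g := by
  ext1 n
  rw [coeff_taylorSeries, coeff_taylorSeries, h.iteratedDeriv_eq]

theorem taylorSeries_const (c : ℂ) : taylorSeries (fun _ => c) = PowerSeries.C c := by
  ext1 n
  rw [coeff_taylorSeries, iteratedDeriv_const, PowerSeries.coeff_C]
  split_ifs with hn <;> simp [hn]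

theorem taylorSeries_id : taylorSeries (fun z => z) = PowerSeries.X := by
  ext1 n
  rw [coeff_taylorSeries, iteratedDeriv_fun_id_zero, PowerSeries.coeff_X]
  split_ifs with hn <;> simp [hn]

theorem taylorSeries_add (hf : AnalyticAt ℂ f 0) (hg : AnalyticAt ℂ g 0) :
    taylorSeries (fun z => f z + g z) = taylorSeries f + taylorSeries g := by
  ext1 n
  rw [map_add, coeff_taylorSeries, iteratedDeriv_fun_add hf.contDiffAt hg.contDiffAt, add_div,
    coeff_taylorSeries, coeff_taylorSeries]

theorem taylorSeries_mul (hf : AnalyticAt ℂ f 0) (hg : AnalyticAt ℂ g 0) :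
    taylorSeries (fun z => f z * g z) = taylorSeries f * taylorSeries g := by
  ext1 n
  rw [coeff_taylorSeries, iteratedDeriv_fun_mul hf.contDiffAt hg.contDiffAt, PowerSeries.coeff_mul,
    Finset.Nat.sum_antidiagonal_eq_sum_range_succ
      (fun i j => PowerSeries.coeff i (taylorSeries f) * PowerSeries.coeff j (taylorSeries g)),
    Finset.sum_div]
  refine Finset.sum_congr rfl fun i hi => ?_
  rw [coeff_taylorSeries, coeff_taylorSeries,
    Nat.cast_choose ℂ (Nat.le_of_lt_succ (Finset.mem_range.mp hi))]
  have hfact (m : ℕ) : (m.factorial : ℂ) ≠ 0 := by exact_mod_cast m.factorial_ne_zero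
  field_simp [hfact]

theorem taylorSeries_pow (hf : AnalyticAt ℂ f 0) (m : ℕ) :
    taylorSeries (fun z => f z ^ m) = taylorSeries f ^ m := by
  induction m with
  | zero => simpa using taylorSeries_const 1
  | succ m ih => simp only [pow_succ, taylorSeries_mul (hf.fun_pow m) hf, ih]

theorem taylorSeries_eval (hf : AnalyticAt ℂ f 0) (P : ℂ[X]) :
    taylorSeries (fun z => P.eval (f z)) = aeval (taylorSeries f) P := by
  have hanalytic (P : ℂ[X]) : AnalyticAt ℂ (fun z => P.eval (f z)) 0 := by
    simpa using hf.aeval_polynomial P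
  induction P using Polynomial.induction_on' with
  | add P Q hP hQ =>
    simp only [eval_add, taylorSeries_add (hanalytic P) (hanalytic Q), hP, hQ, map_add]
  | monomial n a =>
    simp only [eval_monomial, aeval_monomial, taylorSeries_mul analyticAt_const (hf.fun_pow n),
      taylorSeries_pow hf, taylorSeries_const]
    rfl

theorem taylorCoeff_eq_coeff_taylorSeries (A : ℕ → ℂ → ℂ) (k n : ℕ) :
    taylorCoeff A k n = PowerSeries.coeff n (taylorSeries fun z => (-1) ^ k * A k z) := by
  rw [coeff_taylorSeries, iteratedDeriv_const_mul_field, taylorCoeff, mul_div_assoc]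

end TaylorSeries

section FormalSolutionAsymptotics

namespace IsBranch

variable {w : ℂ → ℂ} (hw : IsBranch w)

include hw

theorem analyticAt : AnalyticAt ℂ w 0 :=
  hw.holomorphic.analyticAt (isOpen_disc.mem_nhds zero_mem_disc)

theorem one_sub_two_mul_ne_zero {z : ℂ} (hz : z ∈ disc) : 1 - 2 * w z ≠ 0 := by
  rw [← neg_sub, neg_ne_zero]
  exact hw.two_mul_sub_one_ne_zero hz

theorem analyticAt_inv : AnalyticAt ℂ (fun z => (1 - 2 * w z)⁻¹) 0 :=
  (analyticAt_const.sub (analyticAt_const.mul hw.analyticAt)).fun_inv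
    (hw.one_sub_two_mul_ne_zero zero_mem_disc)

theorem X_mul_taylorSeries : PowerSeries.X * (1 + taylorSeries w) ^ 3 = taylorSeries w := by
  have hcubic := taylorSeries_eval hw.analyticAt ((1 + X) ^ 3)
  simp only [eval_pow, eval_add, eval_one, eval_X, map_pow, map_add, map_one, aeval_X] at hcubic
  have hanalytic : AnalyticAt ℂ (fun z => (1 + w z) ^ 3) 0 :=
    (analyticAt_const.add hw.analyticAt).fun_pow 3
  rw [← hcubic, ← taylorSeries_id,
    ← taylorSeries_mul (f := fun z => z) analyticAt_id hanalytic]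
  exact taylorSeries_congr (eventuallyEq_of_forall_mem_disc hw.eq zero_mem_disc)

theorem taylorSeries_inv_mul :
    taylorSeries (fun z => (1 - 2 * w z)⁻¹) * (1 - 2 * taylorSeries w) = 1 := by
  have hlin := taylorSeries_eval hw.analyticAt (1 - 2 * X)
  simp only [eval_sub, eval_mul, eval_one, eval_ofNat, eval_X, map_sub, map_mul, map_one,
    map_ofNat, aeval_X] at hlin
  have hanalytic : AnalyticAt ℂ (fun z => 1 - 2 * w z) 0 :=
    analyticAt_const.sub (analyticAt_const.mul hw.analyticAt)
  rw [← hlin, ← taylorSeries_mul hw.analyticAt_inv hanalytic, ← map_one PowerSeries.C,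
    ← taylorSeries_const]
  exact taylorSeries_congr (eventuallyEq_of_forall_mem_disc
    (fun z hz => inv_mul_cancel₀ (hw.one_sub_two_mul_ne_zero hz)) zero_mem_disc)

theorem coeffAsymp_taylorSeries {f : ℂ → ℂ} {m : ℕ} {G : ℂ[X]} (hG : G.natDegree ≤ m + 1)
    (hf : ∀ z ∈ disc, f z = G.eval (w z) * (1 - 2 * w z)⁻¹ ^ m) :
    CoeffAsymp (4 / 27) (taylorSeries f) (m * (1 / 2))
      (G.eval (1 / 2) * ((√3)⁻¹ : ℝ) ^ m) := by
  have hanalytic : AnalyticAt ℂ (fun z => G.eval (w z)) 0 := by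
    simpa using hw.analyticAt.aeval_polynomial G
  rw [taylorSeries_congr (eventuallyEq_of_forall_mem_disc hf zero_mem_disc),
    taylorSeries_mul hanalytic (hw.analyticAt_inv.fun_pow m),
    taylorSeries_eval hw.analyticAt, taylorSeries_pow hw.analyticAt_inv]
  exact coeffAsymp_aeval_mul_pow hw.X_mul_taylorSeries hw.taylorSeries_inv_mul m hG

end IsBranch

/-- The polynomials `R_{3(k-1)}`, indexed by `k ≥ 1`; the value at `k = 0` is junk. -/
def rPolynomial (k : ℕ) : ℤ[X] := PowerSeries.coeff (k - 1) rSeries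

theorem valueAtHalf_rPolynomial_ne_zero (k : ℕ) : valueAtHalf rPolynomial k ≠ 0 := by
  rcases k with _ | k
  · norm_num [valueAtHalf]
  · rw [valueAtHalf, if_neg k.succ_ne_zero, rPolynomial, ← coeff_evalHalf]
    exact (coeff_evalHalf_rSeries_pos _).ne'

theorem three_rpow_five_sub_div_two (k : ℕ) :
    (3 : ℝ) ^ ((5 - ((k + 1 : ℕ) : ℝ)) / 2) = 3 ^ (2 * (k + 2)) * (√3)⁻¹ ^ (5 * k + 4) := by
  rw [Real.sqrt_eq_rpow, ← Real.rpow_neg zero_le_three, ← Real.rpow_mul_natCast zero_le_three,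
    ← Real.rpow_natCast 3, ← Real.rpow_add three_pos]
  congr 1
  push_cast
  ring

theorem gamma_five_mul_sub_one_div_two_ne_zero (k : ℕ) :
    Real.Gamma ((5 * (k : ℝ) - 1) / 2) ≠ 0 := by
  refine Real.Gamma_ne_zero fun m h => ?_
  have hcast : ((5 * k + 2 * m : ℕ) : ℝ) = (1 : ℕ) := by
    push_cast
    linarith
  have hnat := Nat.cast_injective hcast
  omega

theorem CoeffAsymp.isEquivalent_mainTerm {R : ℕ → ℤ[X]} {k : ℕ} {F : ℂ⟦X⟧}
    (hR : valueAtHalf R k ≠ 0)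
    (hF : CoeffAsymp (4 / 27) F ((5 * (k : ℝ) - 1) / 2)
      ((3 ^ ((5 - (k : ℝ)) / 2) / 2 ^ (2 * k + 3) * valueAtHalf R k : ℝ) : ℂ)) :
    (fun n => PowerSeries.coeff n F) ~[atTop] fun n => (mainTerm R k n : ℂ) := by
  refine (hF.isEquivalent (div_ne_zero (mul_ne_zero (by positivity) hR)
    (gamma_five_mul_sub_one_div_two_ne_zero k))).congr_right (.of_forall fun n => ?_)
  simp only [mainTerm, show (5 * (k : ℝ) - 3) / 2 = (5 * k - 1) / 2 - 1 by ring]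
  rw [show (4 / 27 : ℂ)⁻¹ = 3 ^ 3 / 2 ^ 2 by norm_num]
  push_cast
  ring

namespace IsFormalSolution

variable {A : ℕ → ℂ → ℂ} (hA : IsFormalSolution A)

include hA

theorem apply_succ (k : ℕ) {z : ℂ} (hz : z ∈ disc) : A (k + 1) z =
    -A 0 z * ((1 + A 0 z) ^ (2 * (k + 2)) / (2 * A 0 z - 1) ^ (5 * k + 4)) *
      aeval (A 0 z) (rPolynomial (k + 1)) := by
  rw [hA.eq_branchSolution _ hz,
    branchSolution_succ _ (hA.isBranch.two_mul_sub_one_ne_zero hz), rPolynomial,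
    Nat.add_sub_cancel]

theorem isRPolynomial {k : ℕ} (hk : 1 ≤ k) : IsRPolynomial A k (rPolynomial k) := by
  obtain ⟨k, rfl⟩ := Nat.exists_eq_add_of_le' hk
  refine ⟨DegreeLE.rSeries _, fun z hz => ?_⟩
  rw [hA.apply_succ k hz, neg_add_eq_sub]
  rfl

theorem coeffAsymp_zero : CoeffAsymp (4 / 27) (taylorSeries fun z => (-1) ^ 0 * A 0 z)
    ((5 * (0 : ℕ) - 1) / 2)
    ((3 ^ ((5 - ((0 : ℕ) : ℝ)) / 2) / 2 ^ (2 * 0 + 3) * valueAtHalf rPolynomial 0 : ℝ) : ℂ) := by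
  simp only [pow_zero, one_mul]
  convert coeffAsymp_branch hA.isBranch.X_mul_taylorSeries hA.isBranch.taylorSeries_inv_mul using 2
  · norm_num
  · rw [valueAtHalf, if_pos rfl, Real.sqrt_eq_rpow,
      show (5 - ((0 : ℕ) : ℝ)) / 2 = 2 + 1 / 2 by norm_num, Real.rpow_add three_pos]
    norm_num
    ring

theorem neg_one_pow_mul_apply_succ (k : ℕ) {z : ℂ} (hz : z ∈ disc) :
    (-1) ^ (k + 1) * A (k + 1) z = A 0 z * (1 + A 0 z) ^ (2 * (k + 2)) *
      aeval (A 0 z) (rPolynomial (k + 1)) * (1 - 2 * A 0 z)⁻¹ ^ (5 * k + 4) := by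
  have hsign : (-1 : ℂ) ^ (5 * k + 4) = (-1) ^ k := by
    rw [show 5 * k + 4 = k + 2 * (2 * k + 2) by ring, pow_add, pow_mul, neg_one_sq, one_pow,
      mul_one]
  rw [hA.apply_succ k hz, ← neg_sub 1 (2 * A 0 z), neg_pow (1 - 2 * A 0 z), hsign, pow_succ,
    inv_pow]
  generalize (1 - 2 * A 0 z) ^ (5 * k + 4) = u
  rcases neg_one_pow_eq_or ℂ k with h | h <;> rw [h] <;> ring

theorem coeffAsymp_succ (k : ℕ) : CoeffAsymp (4 / 27)
    (taylorSeries fun z => (-1) ^ (k + 1) * A (k + 1) z) ((5 * (k + 1 : ℕ) - 1) / 2)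
    ((3 ^ ((5 - ((k + 1 : ℕ) : ℝ)) / 2) / 2 ^ (2 * (k + 1) + 3) *
      valueAtHalf rPolynomial (k + 1) : ℝ) : ℂ) := by
  set R := rPolynomial (k + 1)
  set G : ℂ[X] := X * (1 + X) ^ (2 * (k + 2)) * R.map (Int.castRingHom ℂ) with hG
  have hGdegree : G.natDegree ≤ (5 * k + 4) + 1 := by
    have hRdegree : (R.map (Int.castRingHom ℂ)).natDegree ≤ 3 * k + 0 :=
      natDegree_map_le.trans (DegreeLE.rSeries k)
    have hbase : (1 + X : ℂ[X]).natDegree ≤ 1 := by compute_degree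
    calc G.natDegree ≤ (1 + (2 * (k + 2)) * 1) + (3 * k + 0) :=
          natDegree_mul_le_of_le (natDegree_mul_le_of_le natDegree_X_le
            (natDegree_pow_le_of_le _ hbase)) hRdegree
      _ = 5 * k + 4 + 1 := by ring
  have hGeval (x : ℂ) : G.eval x = x * (1 + x) ^ (2 * (k + 2)) * aeval x R := by
    simp [hG, aeval_def, eval₂_eq_eval_map]
  have h := hA.isBranch.coeffAsymp_taylorSeries (f := fun z => (-1) ^ (k + 1) * A (k + 1) z)
    hGdegree fun z hz => by rw [hGeval, hA.neg_one_pow_mul_apply_succ k hz]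
  convert h using 1
  · push_cast
    ring
  · have haeval : aeval (1 / 2 : ℂ) R = (aeval (1 / 2 : ℝ) R : ℝ) := by
      simpa using aeval_algebraMap_apply ℂ (1 / 2 : ℝ) R
    rw [hGeval, haeval, valueAtHalf, if_neg k.succ_ne_zero, three_rpow_five_sub_div_two]
    push_cast
    rw [show (1 : ℂ) + 1 / 2 = 3 / 2 by norm_num, div_pow]
    ring

end IsFormalSolution

end FormalSolutionAsymptotics

end DegenerateP3

end

theorem mainTheorem7 :
    (∃ A : ℕ → ℂ → ℂ, DegenerateP3.IsFormalSolution A) ∧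
    ∀ A : ℕ → ℂ → ℂ, DegenerateP3.IsFormalSolution A →
      ∃ R : ℕ → ℤ[X],
        (∀ k : ℕ, 1 ≤ k → DegenerateP3.IsRPolynomial A k (R k)) ∧
        ∀ k : ℕ,
          (fun n : ℕ => DegenerateP3.taylorCoeff A k n) ~[atTop]
            (fun n : ℕ => ((DegenerateP3.mainTerm R k n : ℝ) : ℂ)) := by
  obtain ⟨w, hw⟩ := DegenerateP3.exists_isBranch
  refine ⟨⟨_, hw.isFormalSolution⟩, fun A hA =>
    ⟨DegenerateP3.rPolynomial, fun k hk => hA.isRPolynomial hk, fun k => ?_⟩⟩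
  simp only [DegenerateP3.taylorCoeff_eq_coeff_taylorSeries]
  refine DegenerateP3.CoeffAsymp.isEquivalent_mainTerm
    (DegenerateP3.valueAtHalf_rPolynomial_ne_zero k) ?_
  cases k with
  | zero => exact hA.coeffAsymp_zero
  | succ k => exact hA.coeffAsymp_succ k
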